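/- Let $\mathbb H$ be a real separable Hilbert space and let $\xi$ be a Gaussian random element of $\mathbb H$ with mean zero and covariance operator $\Sigma$. Let $\lambda_1\ge\lambda_2\ge\dots\ge 0$ be the eigenvalues of $\Sigma$ in non-increasing order, repeated according to multiplicity (the positive ones, followed by zeros if there are only finitely many of them). Put $\Lambda_k=\bigl(\sum_{j\ge k}\lambda_j^2\bigr)^{1/2}$ for $k=1,2$, and $$ \varkappa(\Sigma)=\begin{cases} \Lambda_1^{-1}, & \text{if } 3\lambda_1^2\le\Lambda_1^2,\\ (\lambda_1\Lambda_2)^{-1/2}, & \text{if } 3\lambda_1^2>\Lambda_1^2,\ 3\lambda_2^2\le\Lambda_2^2,\\ (\lambda_1\lambda_2)^{-1/2}, & \text{if } 3\lambda_1^2>\Lambda_1^2,\ 3\lambda_2^2>\Lambda_2^2, \end{cases} $$ where negative powers of $0$ are read as $+\infty$. There is an absolute constant $C<\infty$ (depending neither on $\mathbb H$ nor on $\xi$) such that $$ \varkappa(\Sigma)\le C\,(\Lambda_1\Lambda_2)^{-1/2}, $$ and, whenever $\Sigma\ne 0$, for every $a\in\mathbb H$ the random variable $\|\xi-a\|^2$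 has a density $p_\xi(\cdot,a)$ with respect to Lebesgue measure, and $$ p_\xi(x,a)\le C\,\varkappa(\Sigma)\quad\text{and}\quad p_\xi(x,a)\le C\,(\Lambda_1\Lambda_2)^{-1/2} \qquad\text{for almost every } x\in\mathbb R . $$ -/

import Mathlib

open MeasureTheory ProbabilityTheory
open scoped ENNReal NNReal

noncomputable section

namespace GaussianNorm

variable {H : Type*} [NormedAddCommGroup H] [InnerProductSpace ℝ H]

/-- The eigenvalues of `T` in non-increasing order, repeated according to multiplicity and indexed
from `0`. The `k`-th one is the largest eigenvalue `μ` such that the eigenspaces of the eigenvalues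
`≥ μ` together span a space of dimension at least `k + 1`. For a nonnegative trace class operator
this lists the positive eigenvalues; if there are only finitely many of them, the list is
continued by zeros (the supremum of the empty set of reals is `0`). -/
def eigenvalueSeq (T : H →L[ℝ] H) (k : ℕ) : ℝ :=
  sSup {μ : ℝ | Module.End.HasEigenvalue (T : H →ₗ[ℝ] H) μ ∧
    (k : Cardinal) + 1 ≤
      Module.rank ℝ (⨆ ν ∈ Set.Ici μ, Module.End.eigenspace (T : H →ₗ[ℝ] H) ν : Submodule ℝ H)}

/-- `lam T k` is the `k`-th largest eigenvalue `λ_k` of `T` (`k = 1, 2, …`), in `[0, ∞]`. -/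
def lam (T : H →L[ℝ] H) (k : ℕ) : ℝ≥0∞ := ENNReal.ofReal (eigenvalueSeq T (k - 1))

/-- `LamSq T k` is `Λ_k² = ∑_{j ≥ k} λ_j²`. -/
def LamSq (T : H →L[ℝ] H) (k : ℕ) : ℝ≥0∞ := ∑' j : ℕ, lam T (k + j) ^ 2

/-- `Lam T k` is `Λ_k`, the nonnegative square root of `Λ_k²`. -/
def Lam (T : H →L[ℝ] H) (k : ℕ) : ℝ≥0∞ := LamSq T k ^ (1 / 2 : ℝ)

open Classical in
/-- The quantity `ϰ(T)`. It takes values in `[0, ∞]`: negative powers of `0` are `∞`. -/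
def kap (T : H →L[ℝ] H) : ℝ≥0∞ :=
  if 3 * lam T 1 ^ 2 ≤ LamSq T 1 then (Lam T 1)⁻¹
  else if 3 * lam T 2 ^ 2 ≤ LamSq T 2 then (lam T 1 * Lam T 2) ^ (-(1 / 2) : ℝ)
  else (lam T 1 * lam T 2) ^ (-(1 / 2) : ℝ)

end GaussianNorm

end

/-! Along orthonormal eigenvectors of the covariance operator the coordinates of `ξ` are independent
N(0, λ_j) variables, and they are independent of the orthogonal remainder. A remainder cannot
enlarge a bound on the characteristic function of the squared norm, nor a bound on its interval
probabilities. Each coordinate contributes a factor of modulus at most (1 + 4λ_j²t²)^(-1/4),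
whatever the centre `a`.

If 3λ_j² ≤ B² for all j, where B² = ∑ λ_j², Bernoulli's inequality turns the product into (1 +
B²t²)^(-3/4), which is integrable with integral of order 1/B. This settles the first case. In the
second, the factor of λ_1 is bounded by (λ_1|t|)^(-1/2) and Bernoulli is applied to the tail. In the
third, two factors decay only like 1/|t|, so the plane is used directly: an annulus s < |p|² ≤ r has
area π(r - s), and the Gaussian density is at most 1/(2π√(λ_1λ_2)).

The comparison with (Λ_1Λ_2)^(-1/2) holds because Λ_k ≤ 2λ_k whenever 3λ_k² > Λ_k². Existence of the
density is proved separately, since `kap` may be infinite.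

No full diagonalization is used: E‖ξ‖² bounds the trace, which makes the upper eigenspaces
finite-dimensional, and finitely many eigenvectors suffice at each step. -/

noncomputable section

namespace GaussianNorm

/-! ### Measures on the line dominated by a multiple of Lebesgue measure -/

/-- Lebesgue outer measure is the largest outer measure dominated by length on intervals, so it lies
above `μ` divided by `K`. -/
theorem le_smul_volume_of_Ioc {μ : Measure ℝ} {K : ℝ≥0} (hK : K ≠ 0)
    (h : ∀ a b, a < b → μ (Set.Ioc a b) ≤ K * ENNReal.ofReal (b - a)) : μ ≤ K • volume := by
  have key : (K⁻¹ • μ).toOuterMeasure ≤ (volume : Measure ℝ).toOuterMeasure := by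
    rw [Real.volume_eq_stieltjes_id]
    have : StieltjesFunction.id.measure.toOuterMeasure
        = (StieltjesFunction.id : StieltjesFunction ℝ).outer := by
      rw [StieltjesFunction.measure]
    rw [this, StieltjesFunction.outer, OuterMeasure.le_ofFunction]
    intro s
    rw [StieltjesFunction.length_eq]
    refine le_iInf fun a ↦ le_iInf fun b ↦ le_iInf fun hs ↦ ?_
    have hs' : s ⊆ Set.Ioc a b := by
      simpa [botSet] using hs
    change (K⁻¹ • μ) s ≤ _
    refine (measure_mono hs').trans ?_
    rw [Measure.smul_apply, ENNReal.smul_def, smul_eq_mul, ENNReal.coe_inv hK]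
    rcases lt_or_ge a b with hab | hab
    · refine (mul_le_mul_right (h a b hab) _).trans ?_
      rw [← mul_assoc, ENNReal.inv_mul_cancel (by simpa using hK) ENNReal.coe_ne_top, one_mul]
      rfl
    · simp [Set.Ioc_eq_empty (not_lt.mpr hab)]
  refine Measure.le_iff'.2 fun s ↦ ?_
  have hs : (K⁻¹ • μ) s ≤ volume s := key s
  rw [Measure.smul_apply, ENNReal.smul_def, smul_eq_mul, ENNReal.coe_inv hK] at hs
  rw [Measure.smul_apply, ENNReal.smul_def, smul_eq_mul]
  calc μ s = K * ((K : ℝ≥0∞)⁻¹ * μ s) := by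
        rw [← mul_assoc, ENNReal.mul_inv_cancel (by simpa using hK) ENNReal.coe_ne_top, one_mul]
    _ ≤ _ := mul_le_mul_right hs _

theorem rnDeriv_le_of_le_smul {α : Type*} [MeasurableSpace α] {μ ν : Measure α} [SigmaFinite ν]
    {K : ℝ≥0} (h : μ ≤ K • ν) : ∀ᵐ x ∂ν, μ.rnDeriv ν x ≤ K := by
  refine ae_le_of_forall_setLIntegral_le_of_sigmaFinite (Measure.measurable_rnDeriv _ _)
    fun s _ _ ↦ ?_
  refine (Measure.setLIntegral_rnDeriv_le s).trans ((h s).trans ?_)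
  rw [setLIntegral_const, Measure.smul_apply, ENNReal.smul_def, smul_eq_mul]

/-! ### Concentration of a measure in terms of its characteristic function -/

theorem gaussianPDFReal_le (m : ℝ) (v : ℝ≥0) (x : ℝ) :
    gaussianPDFReal m v x ≤ (√(2 * Real.pi * v))⁻¹ := by
  rw [gaussianPDFReal]
  refine mul_le_of_le_one_right (by positivity) (Real.exp_le_one_iff.2 ?_)
  exact div_nonpos_of_nonpos_of_nonneg (neg_nonpos.2 (sq_nonneg _)) (by positivity)

/-- Smoothing replaces Fourier inversion: the indicator of the ball is at most √e times a Gaussian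
bump of width `h`, which is itself the characteristic function of N(0, h⁻²). Fubini moves the
integral onto `charFun μ`, and the density of N(0, h⁻²) is at most `h`. -/
theorem measureReal_closedBall_le_integral_charFun {μ : Measure ℝ} [IsProbabilityMeasure μ]
    (hφ : Integrable (charFun μ)) (x : ℝ) {h : ℝ} (hh : 0 < h) :
    μ.real (Metric.closedBall x h) ≤ Real.exp (1 / 2) * h * ∫ t, ‖charFun μ t‖ := by
  obtain ⟨v, hv⟩ : ∃ v : ℝ≥0, (v : ℝ) = (h ^ 2)⁻¹ := ⟨⟨(h ^ 2)⁻¹, by positivity⟩, rfl⟩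
  have hv0 : v ≠ 0 := by
    rintro rfl
    exact (by positivity : (h ^ 2)⁻¹ ≠ 0) hv.symm
  set γ := gaussianReal 0 v with hγ
  set f : ℝ → ℝ := fun y ↦ Real.exp (-(y - x) ^ 2 / (2 * h ^ 2)) with hf
  have hf1 : ∀ y, f y ≤ 1 := fun y ↦ Real.exp_le_one_iff.2
    (div_nonpos_of_nonpos_of_nonneg (neg_nonpos.2 (sq_nonneg _)) (by positivity))
  have hfi : Integrable f μ := by
    refine Integrable.of_bound (C := 1) (by fun_prop) (.of_forall fun y ↦ ?_)
    rw [Real.norm_of_nonneg (Real.exp_nonneg _)]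
    exact hf1 y
  have h1 : μ.real (Metric.closedBall x h) ≤ Real.exp (1 / 2) * ∫ y, f y ∂μ := by
    rw [← integral_const_mul, ← integral_indicator_one Metric.isClosed_closedBall.measurableSet]
    refine integral_mono ?_ (hfi.const_mul _) fun y ↦ ?_
    · exact (integrable_const (1 : ℝ)).indicator Metric.isClosed_closedBall.measurableSet
    · refine Set.indicator_apply_le' (fun hy ↦ ?_) fun _ ↦ by positivity
      rw [hf, ← Real.exp_add, Pi.one_apply]
      refine Real.one_le_exp ?_
      have hy' : |y - x| ≤ h := by simpa [Real.dist_eq] using hy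
      have : (y - x) ^ 2 ≤ h ^ 2 := sq_le_sq' (abs_le.1 hy').1 (abs_le.1 hy').2
      rw [neg_div, ← sub_eq_add_neg, sub_nonneg, div_le_div_iff₀ (by positivity) (by positivity)]
      linarith
  have h2 : ((∫ y, f y ∂μ : ℝ) : ℂ)
      = ∫ t, Complex.exp (-(t * x * Complex.I)) * charFun μ t ∂γ := by
    calc ((∫ y, f y ∂μ : ℝ) : ℂ) = ∫ y, ((f y : ℝ) : ℂ) ∂μ := integral_complex_ofReal.symm
      _ = ∫ y, ∫ t, Complex.exp ((y - x) * t * Complex.I) ∂γ ∂μ := by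
          refine integral_congr_ae (.of_forall fun y ↦ ?_)
          have := charFun_gaussianReal (μ := 0) (v := v) (y - x)
          rw [charFun_apply_real] at this
          push_cast at this
          simp only [hγ]
          rw [this, hf, Complex.ofReal_exp]
          congr 1
          rw [hv]
          push_cast
          have : (h : ℂ) ≠ 0 := by exact_mod_cast hh.ne'
          field_simp
          ring
      _ = ∫ t, ∫ y, Complex.exp ((y - x) * t * Complex.I) ∂μ ∂γ := by
          refine integral_integral_swap ?_
          refine Integrable.of_bound (C := 1) (by fun_prop) (.of_forall fun p ↦ ?_)
          have : ((p.1 : ℂ) - x) * p.2 * Complex.I = ((p.1 - x) * p.2 : ℝ) * Complex.I := by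
            push_cast; rfl
          simp only [Function.uncurry]
          rw [this, Complex.norm_exp_ofReal_mul_I]
      _ = _ := by
          refine integral_congr_ae (.of_forall fun t ↦ ?_)
          simp only
          rw [charFun_apply_real, ← integral_const_mul]
          congr 1
          ext y
          rw [← Complex.exp_add]
          congr 1
          ring
  have h3 : ∫ y, f y ∂μ ≤ h * ∫ t, ‖charFun μ t‖ := by
    have hpos : 0 ≤ ∫ y, f y ∂μ := integral_nonneg fun y ↦ Real.exp_nonneg _
    calc ∫ y, f y ∂μ = ‖((∫ y, f y ∂μ : ℝ) : ℂ)‖ := by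
          rw [Complex.norm_real, Real.norm_of_nonneg hpos]
      _ ≤ ∫ t, ‖charFun μ t‖ ∂γ := by
          rw [h2]
          refine (norm_integral_le_integral_norm _).trans_eq ?_
          congr 1
          ext t
          have : -((t : ℂ) * x * Complex.I) = ((-(t * x) : ℝ) : ℂ) * Complex.I := by
            push_cast; ring
          rw [norm_mul, this, Complex.norm_exp_ofReal_mul_I, one_mul]
      _ = ∫ t, gaussianPDFReal 0 v t • ‖charFun μ t‖ :=
          integral_gaussianReal_eq_integral_smul hv0
      _ ≤ ∫ t, h * ‖charFun μ t‖ := by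
          refine integral_mono_of_nonneg (.of_forall fun t ↦ ?_) (hφ.norm.const_mul _)
            (.of_forall fun t ↦ ?_)
          · exact smul_nonneg (gaussianPDFReal_nonneg _ _ _) (norm_nonneg _)
          · refine mul_le_mul_of_nonneg_right ((gaussianPDFReal_le 0 v t).trans ?_) (norm_nonneg _)
            rw [inv_le_comm₀ (by positivity) hh]
            refine Real.le_sqrt_of_sq_le ?_
            rw [hv, inv_pow]
            refine le_mul_of_one_le_left (by positivity) ?_
            linarith [Real.pi_gt_three]
      _ = _ := integral_const_mul _ _
  calc _ ≤ _ := h1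
    _ ≤ Real.exp (1 / 2) * (h * ∫ t, ‖charFun μ t‖) := by gcongr
    _ = _ := by ring

/-- The profile to which characteristic functions of quadratic forms are compared. -/
def profile (t : ℝ) : ℝ := |t| ^ (-(1 / 2) : ℝ) * (1 + t ^ 2) ^ (-(1 / 2) : ℝ)

theorem profile_nonneg (t : ℝ) : 0 ≤ profile t := by
  unfold profile; positivity

theorem integrable_profile : Integrable profile := by
  have hm : Measurable profile := by unfold profile; fun_prop
  have hpos : IntegrableOn profile (Set.Ioi 0) := by
    rw [← Set.Ioc_union_Ioi_eq_Ioi zero_le_one]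
    refine IntegrableOn.union ?_ ?_
    · have : IntegrableOn (fun t : ℝ ↦ t ^ (-(1 / 2) : ℝ)) (Set.Ioc 0 1) := by
        rw [← intervalIntegrable_iff_integrableOn_Ioc_of_le zero_le_one]
        exact intervalIntegral.intervalIntegrable_rpow' (by norm_num)
      refine Integrable.mono' this hm.aestronglyMeasurable ?_
      refine (ae_restrict_iff' measurableSet_Ioc).2 (.of_forall fun t ht ↦ ?_)
      rw [Real.norm_of_nonneg (profile_nonneg t), profile, abs_of_pos ht.1]
      refine mul_le_of_le_one_right (Real.rpow_nonneg ht.1.le _) ?_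
      exact Real.rpow_le_one_of_one_le_of_nonpos (by nlinarith) (by norm_num)
    · refine Integrable.mono' (integrableOn_Ioi_rpow_of_lt (a := -(3 / 2)) (by norm_num) one_pos)
        hm.aestronglyMeasurable ?_
      refine (ae_restrict_iff' measurableSet_Ioi).2 (.of_forall fun t ht ↦ ?_)
      have ht0 : 0 < t := one_pos.trans ht
      rw [Real.norm_of_nonneg (profile_nonneg t), profile, abs_of_pos ht0]
      have : (1 + t ^ 2) ^ (-(1 / 2) : ℝ) ≤ t ^ (-1 : ℝ) := by
        calc (1 + t ^ 2) ^ (-(1 / 2) : ℝ) ≤ (t ^ 2) ^ (-(1 / 2) : ℝ) :=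
              Real.rpow_le_rpow_of_nonpos (by positivity) (by linarith) (by norm_num)
          _ = _ := by
              rw [← Real.rpow_natCast, ← Real.rpow_mul ht0.le]; norm_num
      calc _ ≤ t ^ (-(1 / 2) : ℝ) * t ^ (-1 : ℝ) := by gcongr
        _ = _ := by rw [← Real.rpow_add ht0]; norm_num
  have hneg : IntegrableOn profile (Set.Iic 0) := by
    have h := (integrableOn_Ici_iff_integrableOn_Ioi (μ := volume)).2 hpos
    have h2 := h.comp_neg
    simp only [Set.neg_Ici, neg_zero] at h2
    refine h2.congr_fun (fun t _ ↦ ?_) measurableSet_Iic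
    simp [profile]
  rw [← integrableOn_univ, ← Set.Iic_union_Ioi (a := (0 : ℝ))]
  exact hneg.union hpos

/-- The absolute constant in the density bound obtained from characteristic functions. -/
def charFunConst : ℝ≥0 := ⟨Real.exp (1 / 2) * ∫ t, profile t,
  mul_nonneg (Real.exp_nonneg _) (integral_nonneg profile_nonneg)⟩

theorem le_smul_volume_of_charFun_le {μ : Measure ℝ} [IsProbabilityMeasure μ] {A B : ℝ≥0}
    (hA : 0 < A) (hB : 0 < B)
    (h : ∀ t ≠ 0, ‖charFun μ t‖ ≤ (A * |t|) ^ (-(1 / 2) : ℝ) *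
      (1 + B ^ 2 * t ^ 2) ^ (-(1 / 2) : ℝ)) :
    μ ≤ ((charFunConst + 1) * (A * B) ^ (-(1 / 2) : ℝ)) • volume := by
  have hA' : (0 : ℝ) < A := hA
  have hB' : (0 : ℝ) < B := hB
  -- The constant comes from writing A|t| as (A/B)·|Bt|, which makes the bound a rescaled `profile`.
  set c : ℝ := (B : ℝ) ^ (1 / 2 : ℝ) * (A : ℝ) ^ (-(1 / 2) : ℝ) with hc
  have h' : ∀ t ≠ 0, ‖charFun μ t‖ ≤ c * profile (B * t) := by
    intro t ht
    refine (h t ht).trans_eq ?_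
    rw [profile, abs_mul, abs_of_pos hB', Real.mul_rpow hA'.le (abs_nonneg t),
      Real.mul_rpow hB'.le (abs_nonneg t), mul_pow, hc]
    have : (B : ℝ) ^ (1 / 2 : ℝ) * (B : ℝ) ^ (-(1 / 2) : ℝ) = 1 := by
      rw [← Real.rpow_add hB']; norm_num
    linear_combination -(A : ℝ) ^ (-(1 / 2) : ℝ) * |t| ^ (-(1 / 2) : ℝ) *
      (1 + (B : ℝ) ^ 2 * t ^ 2) ^ (-(1 / 2) : ℝ) * this
  have hae : ∀ᵐ t : ℝ, ‖charFun μ t‖ ≤ c * profile (B * t) := by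
    filter_upwards [compl_mem_ae_iff.2 (measure_singleton (μ := volume) (0 : ℝ))] with t ht
    exact h' t ht
  have hfun : Integrable fun t ↦ c * profile (B * t) :=
    (integrable_profile.comp_mul_left' hB'.ne').const_mul c
  have hφ : Integrable (charFun μ) :=
    hfun.mono' (measurable_charFun.aestronglyMeasurable) hae
  have hI : ∫ t, ‖charFun μ t‖ ≤ (A * B : ℝ) ^ (-(1 / 2) : ℝ) * ∫ t, profile t := by
    refine (integral_mono_ae hφ.norm hfun hae).trans_eq ?_
    rw [integral_const_mul, Measure.integral_comp_mul_left, smul_eq_mul,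
      abs_of_pos (inv_pos.2 hB'), Real.mul_rpow hA'.le hB'.le, hc, ← mul_assoc]
    congr 1
    have : (B : ℝ) ^ (1 / 2 : ℝ) * (B : ℝ)⁻¹ = (B : ℝ) ^ (-(1 / 2) : ℝ) := by
      rw [← Real.rpow_neg_one (B : ℝ), ← Real.rpow_add hB']; norm_num
    rw [← this]; ring
  -- The summand 1 added to `charFunConst` makes the constant visibly nonzero; it also covers the
  -- planar case later.
  refine le_smul_volume_of_Ioc ?_ fun a b hab ↦ ?_
  · exact (mul_pos (by positivity) (NNReal.rpow_pos (mul_pos hA hB))).ne'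
  · have hsub : Set.Ioc a b ⊆ Metric.closedBall ((a + b) / 2) ((b - a) / 2) := by
      rw [Real.closedBall_eq_Icc]
      intro y hy
      constructor <;> linarith [hy.1, hy.2]
    have hb := measureReal_closedBall_le_integral_charFun hφ ((a + b) / 2)
      (h := (b - a) / 2) (by linarith)
    refine (measure_mono hsub).trans ?_
    rw [← ofReal_measureReal, ← ENNReal.ofReal_coe_nnreal,
      ← ENNReal.ofReal_mul (NNReal.coe_nonneg _)]
    refine ENNReal.ofReal_le_ofReal (hb.trans ?_)
    have hP : 0 ≤ ∫ t, profile t := integral_nonneg profile_nonneg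
    have hR : 0 ≤ (A * B : ℝ) ^ (-(1 / 2) : ℝ) := by positivity
    have hba : 0 < b - a := sub_pos.2 hab
    push_cast
    have hcc : (charFunConst : ℝ) = Real.exp (1 / 2) * ∫ t, profile t := rfl
    rw [hcc]
    calc Real.exp (1 / 2) * ((b - a) / 2) * ∫ t, ‖charFun μ t‖
        ≤ Real.exp (1 / 2) * ((b - a) / 2) * ((A * B : ℝ) ^ (-(1 / 2) : ℝ) * ∫ t, profile t) := by
          gcongr
      _ = (1 / 2) * (Real.exp (1 / 2) * (∫ t, profile t) *
            ((A * B : ℝ) ^ (-(1 / 2) : ℝ)) * (b - a)) := by ring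
      _ ≤ 1 * (Real.exp (1 / 2) * (∫ t, profile t) *
            ((A * B : ℝ) ^ (-(1 / 2) : ℝ)) * (b - a)) := by
          gcongr; norm_num
      _ ≤ _ := by
          rw [one_mul]
          gcongr
          linarith

/-! ### Eigenvalues of symmetric operators with bounded trace -/

section Spectral

open Module.End
open scoped InnerProductSpace

variable {H : Type*} [NormedAddCommGroup H] [InnerProductSpace ℝ H]

/-- The span of the eigenspaces of all eigenvalues `≥ μ`. -/
def upperEigenspace (T : H →L[ℝ] H) (μ : ℝ) : Submodule ℝ H :=
  ⨆ ν ∈ Set.Ici μ, eigenspace (T : H →ₗ[ℝ] H) ν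

theorem upperEigenspace_anti (T : H →L[ℝ] H) {μ μ' : ℝ} (h : μ ≤ μ') :
    upperEigenspace T μ' ≤ upperEigenspace T μ :=
  biSup_mono fun _ hν ↦ h.trans hν

theorem apply_mem_upperEigenspace (T : H →L[ℝ] H) (μ : ℝ) {x : H}
    (hx : x ∈ upperEigenspace T μ) : (T : H →ₗ[ℝ] H) x ∈ upperEigenspace T μ := by
  suffices upperEigenspace T μ ≤ (upperEigenspace T μ).comap (T : H →ₗ[ℝ] H) from this hx
  refine iSup₂_le fun ν hν y hy ↦ ?_
  rw [Submodule.mem_comap, mem_eigenspace_iff.1 hy]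
  exact Submodule.smul_mem _ _ (le_iSup₂ (f := fun ν (_ : ν ∈ Set.Ici μ) ↦
    eigenspace (T : H →ₗ[ℝ] H) ν) ν hν hy)

theorem inner_eq_zero_of_mem_upperEigenspace {T : H →L[ℝ] H}
    (hT : (T : H →ₗ[ℝ] H).IsSymmetric) {μ c : ℝ} {v x : H} (hv : T v = c • v) (hc : c < μ)
    (hx : x ∈ upperEigenspace T μ) : ⟪v, x⟫_ℝ = 0 := by
  suffices upperEigenspace T μ ≤ (Submodule.span ℝ {v})ᗮ from
    Submodule.mem_orthogonal_singleton_iff_inner_right.1 (this hx)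
  refine iSup₂_le fun ν hν y hy ↦ Submodule.mem_orthogonal_singleton_iff_inner_right.2 ?_
  have h := hT v y
  rw [mem_eigenspace_iff.1 hy, ContinuousLinearMap.coe_coe, hv, inner_smul_left,
    inner_smul_right] at h
  have hne : c - ν ≠ 0 := (sub_neg.2 (hc.trans_le hν)).ne
  have h0 : (c - ν) * ⟪v, y⟫_ℝ = 0 := by
    simp only [conj_trivial] at h
    linarith
  exact (mul_eq_zero.1 h0).resolve_left hne

theorem mul_norm_sq_le_inner {T : H →L[ℝ] H} (hT : (T : H →ₗ[ℝ] H).IsSymmetric) {μ : ℝ} {x : H}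
    (hx : x ∈ upperEigenspace T μ) : μ * ‖x‖ ^ 2 ≤ ⟪T x, x⟫_ℝ := by
  rw [upperEigenspace, iSup_subtype', Submodule.mem_iSup_iff_exists_finsupp] at hx
  obtain ⟨f, hf, rfl⟩ := hx
  have hortho := hT.orthogonalFamily_eigenspaces.comp
    (Subtype.coe_injective : Function.Injective ((↑) : Set.Ici μ → ℝ))
  set g : ∀ ν : Set.Ici μ, eigenspace (T : H →ₗ[ℝ] H) ν := fun ν ↦ ⟨f ν, hf ν⟩ with hg
  have hsum : (f.sum fun _ xi ↦ xi) = ∑ ν ∈ f.support,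
      (eigenspace (T : H →ₗ[ℝ] H) (ν : ℝ)).subtypeₗᵢ (g ν) := rfl
  have hTsum : T (f.sum fun _ xi ↦ xi) = ∑ ν ∈ f.support,
      (eigenspace (T : H →ₗ[ℝ] H) (ν : ℝ)).subtypeₗᵢ ((ν : ℝ) • g ν) := by
    rw [hsum, map_sum]
    exact Finset.sum_congr rfl fun ν _ ↦ mem_eigenspace_iff.1 (hf ν)
  rw [hTsum, ← real_inner_self_eq_norm_sq, hsum]
  have e1 := hortho.inner_sum (fun ν ↦ (ν : ℝ) • g ν) g f.support
  have e2 := hortho.inner_sum g g f.support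
  simp only at e1 e2
  rw [e1, e2, Finset.mul_sum]
  refine Finset.sum_le_sum fun ν _ ↦ ?_
  rw [real_inner_smul_left]
  exact mul_le_mul_of_nonneg_right ν.2 real_inner_self_nonneg

/-- The sums `∑ ⟪T e_i, e_i⟫` over finite orthonormal families are bounded by `M`. -/
def TraceLE (T : H →L[ℝ] H) (M : ℝ) : Prop :=
  ∀ (n : ℕ) (e : Fin n → H), Orthonormal ℝ e → ∑ i, ⟪T (e i), e i⟫_ℝ ≤ M

/-- Each of n orthonormal vectors in this space contributes at least `μ` to the trace, so nμ ≤ M. -/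
theorem finiteDimensional_upperEigenspace {T : H →L[ℝ] H}
    (hT : (T : H →ₗ[ℝ] H).IsSymmetric) {M : ℝ} (htr : TraceLE T M) {μ : ℝ} (hμ : 0 < μ) :
    FiniteDimensional ℝ (upperEigenspace T μ) := by
  by_contra hfin
  obtain ⟨n, hn⟩ := exists_nat_gt (M / μ)
  have hrank : (n : Cardinal) ≤ Module.rank ℝ (upperEigenspace T μ) := by
    refine (Cardinal.natCast_le_aleph0).trans (not_lt.1 fun h ↦ hfin ?_)
    exact Module.rank_lt_aleph0_iff.1 h
  obtain ⟨v, hv⟩ := Module.le_rank_iff.1 hrank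
  have he := (InnerProductSpace.gramSchmidtNormed_orthonormal hv).comp_linearIsometry
    (upperEigenspace T μ).subtypeₗᵢ
  have h := htr n _ he
  have h2 : ∑ _i : Fin n, μ ≤ M := by
    refine le_trans (Finset.sum_le_sum fun i _ ↦ ?_) h
    have := mul_norm_sq_le_inner hT (InnerProductSpace.gramSchmidtNormed ℝ v i).2
    have hn1 := he.norm_eq_one i
    simp only [Function.comp_apply, Submodule.coe_subtypeₗᵢ, Submodule.coe_subtype] at hn1 ⊢
    rwa [hn1, one_pow, mul_one] at this
  rw [Finset.sum_const, Finset.card_univ, Fintype.card_fin, nsmul_eq_mul] at h2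
  rw [div_lt_iff₀ hμ] at hn
  linarith

/-- Diagonalize the restriction of `T` to a finite-dimensional upper eigenspace of dimension at
least n + 1. The inequality `eigenvalueSeq T i ≤ γ i` is enough, since all later bounds decrease in
the eigenvalues. -/
theorem exists_orthonormal_eigenvectors {T : H →L[ℝ] H}
    (hT : (T : H →ₗ[ℝ] H).IsSymmetric) {M : ℝ} (htr : TraceLE T M) {n : ℕ}
    (hn : 0 < eigenvalueSeq T n) :
    ∃ (e : Fin (n + 1) → H) (γ : Fin (n + 1) → ℝ), Orthonormal ℝ e ∧
      ∀ i, T (e i) = γ i • e i ∧ 0 < γ i ∧ eigenvalueSeq T i ≤ γ i := by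
  obtain ⟨μ, ⟨-, hμrank⟩, hμ⟩ : ∃ μ ∈ {μ : ℝ | HasEigenvalue (T : H →ₗ[ℝ] H) μ ∧
      (n : Cardinal) + 1 ≤ Module.rank ℝ (upperEigenspace T μ)}, 0 < μ := by
    refine exists_lt_of_lt_csSup (Set.nonempty_iff_ne_empty.2 fun h0 ↦ ?_) hn
    rw [eigenvalueSeq] at hn
    unfold upperEigenspace at h0
    rw [h0, Real.sSup_empty] at hn
    exact lt_irrefl _ hn
  set W := upperEigenspace T μ with hW
  have hfd : FiniteDimensional ℝ W := finiteDimensional_upperEigenspace hT htr hμ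
  have hinv : ∀ x ∈ W, (T : H →ₗ[ℝ] H) x ∈ W := fun x hx ↦ apply_mem_upperEigenspace T μ hx
  have hTW := hT.restrict_invariant hinv
  set d := Module.finrank ℝ W with hd
  have hnd : n + 1 ≤ d := by
    rw [← Module.finrank_eq_rank] at hμrank
    exact_mod_cast hμrank
  set b := hTW.eigenvectorBasis (n := d) rfl with hb
  set g := hTW.eigenvalues (n := d) rfl with hg
  have hTb : ∀ j, T (b j) = g j • (b j : H) := fun j ↦
    congrArg Subtype.val (hTW.apply_eigenvectorBasis (n := d) rfl j)
  have hbo : Orthonormal ℝ (fun j ↦ (b j : H)) :=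
    b.orthonormal.comp_linearIsometry W.subtypeₗᵢ
  have hgμ : ∀ j, μ ≤ g j := fun j ↦ by
    have h := mul_norm_sq_le_inner hT (b j).2
    have h1 : ‖(b j : H)‖ = 1 := hbo.norm_eq_one j
    rw [hTb, real_inner_smul_left, real_inner_self_eq_norm_sq, h1] at h
    simpa using h
  refine ⟨fun i ↦ b (Fin.castLE hnd i), fun i ↦ g (Fin.castLE hnd i),
    hbo.comp _ (Fin.castLE_injective hnd), fun i ↦ ⟨hTb _, hμ.trans_le (hgμ _), ?_⟩⟩
  set i' := Fin.castLE hnd i with hi'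
  refine Real.sSup_le (fun μ' hμ' ↦ ?_) (hμ.le.trans (hgμ i'))
  -- An admissible `μ'` above `g i'` would have its upper eigenspace inside `W` and orthogonal to
  -- every `b j` with j ≥ i. It would then be spanned by i vectors, against rank at least i + 1.
  by_contra! hlt
  have hμμ' : μ ≤ μ' := (hgμ i').trans hlt.le
  have hrank : ((i : ℕ) : Cardinal) + 1 ≤ Module.rank ℝ (upperEigenspace T μ') := hμ'.2
  have hle : upperEigenspace T μ' ≤
      Submodule.span ℝ (Set.range fun j : Fin i ↦ (b ⟨j, j.2.trans i'.2⟩ : H)) := by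
    intro x hx
    have hxW : x ∈ W := upperEigenspace_anti T hμμ' hx
    have hx_eq : x = ∑ j, ⟪(b j : H), x⟫_ℝ • (b j : H) := by
      have := congrArg Subtype.val (b.sum_repr' ⟨x, hxW⟩)
      simpa using this.symm
    rw [hx_eq]
    refine Submodule.sum_mem _ fun j _ ↦ ?_
    rcases lt_or_ge (j : ℕ) i with hj | hj
    · exact Submodule.smul_mem _ _ (Submodule.subset_span ⟨⟨j, hj⟩, rfl⟩)
    · have hgj : g j ≤ g i' := hTW.eigenvalues_antitone (n := d) rfl (show i' ≤ j from hj)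
      rw [inner_eq_zero_of_mem_upperEigenspace hT (hTb j) (hgj.trans_lt hlt) hx, zero_smul]
      exact Submodule.zero_mem _
  have hr := Submodule.rank_mono hle
  have hfin : Module.finrank ℝ (Submodule.span ℝ
      (Set.range fun j : Fin i ↦ (b ⟨j, j.2.trans i'.2⟩ : H))) ≤ i := by
    simpa [Set.finrank] using finrank_range_le_card (R := ℝ)
      (b := fun j : Fin i ↦ (b ⟨j, j.2.trans i'.2⟩ : H))
  have : FiniteDimensional ℝ (Submodule.span ℝ
      (Set.range fun j : Fin i ↦ (b ⟨j, j.2.trans i'.2⟩ : H))) :=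
    FiniteDimensional.span_of_finite ℝ (Set.finite_range _)
  rw [← Module.finrank_eq_rank ℝ (Submodule.span ℝ _)] at hr
  have hcontra := hrank.trans hr
  have : (i : ℕ) + 1 ≤ (i : ℕ) := by
    refine le_trans ?_ hfin
    exact_mod_cast hcontra
  omega

/-- The `k`-th largest eigenvalue (indexed from `0`), as a nonnegative real. -/
def ell (T : H →L[ℝ] H) (k : ℕ) : ℝ≥0 := (eigenvalueSeq T k).toNNReal

theorem lam_succ (T : H →L[ℝ] H) (k : ℕ) : lam T (k + 1) = ell T k := rfl

theorem ell_antitone (T : H →L[ℝ] H) : Antitone (ell T) := by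
  refine antitone_nat_of_succ_le fun k ↦ Real.toNNReal_le_iff_le_coe.2 ?_
  rw [ell, Real.coe_toNNReal']
  rcases Set.eq_empty_or_nonempty {μ : ℝ | HasEigenvalue (T : H →ₗ[ℝ] H) μ ∧
    ((k + 1 : ℕ) : Cardinal) + 1 ≤ Module.rank ℝ (upperEigenspace T μ)} with h | h
  · unfold upperEigenspace at h
    rw [eigenvalueSeq, h, Real.sSup_empty]
    exact le_max_right _ _
  · refine le_max_of_le_left (csSup_le_csSup ⟨‖T‖, fun μ hμ ↦ ?_⟩ h fun μ hμ ↦ ⟨hμ.1, ?_⟩)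
    · obtain ⟨v, hv⟩ := hμ.1.exists_hasEigenvector
      have h1 : T v = μ • v := hv.apply_eq_smul
      have h2 := T.le_opNorm v
      rw [h1, norm_smul] at h2
      exact (le_abs_self μ).trans (le_of_mul_le_mul_right h2 (norm_pos_iff.2 hv.2))
    · refine le_trans ?_ hμ.2
      push_cast
      exact le_self_add

theorem sum_ell_le {T : H →L[ℝ] H} (hT : (T : H →ₗ[ℝ] H).IsSymmetric) {M : ℝ}
    (htr : TraceLE T M) (n : ℕ) : ∑ j ∈ Finset.range n, (ell T j : ℝ) ≤ M := by
  induction n with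
  | zero => simpa using htr 0 Fin.elim0 (by simp [Orthonormal])
  | succ n ih =>
    rcases le_or_gt (eigenvalueSeq T n) 0 with h0 | hpos
    · rw [Finset.sum_range_succ, ell, Real.toNNReal_of_nonpos h0]
      simpa using ih
    · obtain ⟨e, γ, he, hγ⟩ := exists_orthonormal_eigenvectors hT htr hpos
      refine le_trans ?_ (htr _ e he)
      rw [Finset.sum_range]
      refine Finset.sum_le_sum fun i _ ↦ ?_
      rw [(hγ i).1, real_inner_smul_left, real_inner_self_eq_norm_sq, he.norm_eq_one, one_pow,
        mul_one, ell, Real.coe_toNNReal']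
      exact max_le (hγ i).2.2 (hγ i).2.1.le

theorem summable_ell_sq {T : H →L[ℝ] H} (hT : (T : H →ₗ[ℝ] H).IsSymmetric) {M : ℝ}
    (htr : TraceLE T M) : Summable fun j ↦ ell T j ^ 2 := by
  have h1 : Summable fun j ↦ ell T j := by
    rw [← NNReal.summable_coe]
    exact summable_of_sum_range_le (fun _ ↦ NNReal.coe_nonneg _) (sum_ell_le hT htr)
  -- The squares are dominated by ℓ_0 ℓ_j, and the ℓ_j are summable by the trace bound.
  refine NNReal.summable_of_le (fun j ↦ ?_) (h1.mul_left (ell T 0))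
  rw [sq]
  exact mul_le_mul_left (ell_antitone T (Nat.zero_le j)) _

end Spectral

/-! ### Quadratic functions of one and two real Gaussian variables -/

/-- With b = it - 1/(2v), the Gaussian integral has modulus (2v|b|)^(-1/2) times that of an
exponential whose exponent has real part (ta)² Re(1/b) ≤ 0. Hence shifting the centre can only
decrease it. -/
theorem norm_integral_cexp_sq_gaussianReal_le {v : ℝ≥0} (hv : v ≠ 0) (a t : ℝ) :
    ‖∫ x, Complex.exp (t * ((x - a) ^ 2 : ℝ) * Complex.I) ∂gaussianReal 0 v‖ ≤
      (1 + 4 * (v : ℝ) ^ 2 * t ^ 2) ^ (-(1 / 4) : ℝ) := by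
  have hv0 : (0 : ℝ) < v := NNReal.coe_pos.2 (pos_iff_ne_zero.2 hv)
  have hvc : (v : ℂ) ≠ 0 := by exact_mod_cast hv0.ne'
  set b : ℂ := ⟨-(1 / (2 * v)), t⟩ with hb
  have hb' : b = t * Complex.I - 1 / (2 * v) := by
    apply Complex.ext <;> simp [hb]
  have hbre : b.re < 0 := by simp [hb, hv0]
  have hb0 : b ≠ 0 := by rintro h; simp [h] at hbre
  rw [integral_gaussianReal_eq_integral_smul hv]
  have hfun : ∀ x : ℝ, gaussianPDFReal 0 v x • Complex.exp (t * ((x - a) ^ 2 : ℝ) * Complex.I)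
      = ((√(2 * Real.pi * v))⁻¹ : ℝ) * Complex.exp
        (b * (x : ℂ) ^ 2 + (-2 * t * a * Complex.I) * x + t * a ^ 2 * Complex.I) := by
    intro x
    rw [gaussianPDFReal, Complex.real_smul, Complex.ofReal_mul, mul_assoc, Complex.ofReal_exp,
      ← Complex.exp_add]
    congr 2
    rw [hb']
    push_cast
    field_simp
    ring
  simp_rw [hfun]
  rw [integral_const_mul, integral_cexp_quadratic hbre, norm_mul, norm_mul]
  have h1 : ‖Complex.exp (t * a ^ 2 * Complex.I - (-2 * t * a * Complex.I) ^ 2 / (4 * b))‖ ≤ 1 := by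
    rw [Complex.norm_exp, Real.exp_le_one_iff]
    have : (t * a ^ 2 * Complex.I - (-2 * t * a * Complex.I) ^ 2 / (4 * b) : ℂ)
        = ((t * a ^ 2 : ℝ) : ℂ) * Complex.I + (((t * a) ^ 2 : ℝ) : ℂ) * b⁻¹ := by
      push_cast
      rw [mul_pow, Complex.I_sq]
      field_simp
      ring
    rw [this, Complex.add_re, Complex.re_ofReal_mul, Complex.re_ofReal_mul, Complex.I_re, mul_zero,
      zero_add, Complex.inv_re]
    exact mul_nonpos_of_nonneg_of_nonpos (sq_nonneg _)
      (div_nonpos_of_nonpos_of_nonneg hbre.le (Complex.normSq_nonneg _))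
  have h2 : ‖((Real.pi : ℂ) / -b) ^ (1 / 2 : ℂ)‖ = √(Real.pi / ‖b‖) := by
    have : (1 / 2 : ℂ) = ((1 / 2 : ℝ) : ℂ) := by push_cast; rfl
    rw [this, Complex.norm_cpow_real, norm_div, norm_neg, Complex.norm_real,
      Real.norm_of_nonneg Real.pi_pos.le, Real.sqrt_eq_rpow]
  have h3 : 2 * v * ‖b‖ = √(1 + 4 * (v : ℝ) ^ 2 * t ^ 2) := by
    rw [eq_comm, Real.sqrt_eq_iff_mul_self_eq (by positivity) (by positivity)]
    have : ‖b‖ * ‖b‖ = (1 / (2 * v)) ^ 2 + t ^ 2 := by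
      rw [Complex.norm_mul_self_eq_normSq, Complex.normSq_apply]
      simp only [hb]
      ring
    symm
    calc 2 * (v : ℝ) * ‖b‖ * (2 * v * ‖b‖) = 4 * (v : ℝ) ^ 2 * (‖b‖ * ‖b‖) := by ring
      _ = _ := by rw [this]; field_simp; ring
  have hbn : 0 < ‖b‖ := norm_pos_iff.2 hb0
  calc _ ≤ ‖(((√(2 * Real.pi * v))⁻¹ : ℝ) : ℂ)‖ * (√(Real.pi / ‖b‖) * 1) := by
        rw [h2]; gcongr
    _ = (√(2 * v * ‖b‖))⁻¹ := by
        rw [mul_one, Complex.norm_real, Real.norm_of_nonneg (by positivity), ← Real.sqrt_inv,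
          ← Real.sqrt_inv, ← Real.sqrt_mul (by positivity)]
        congr 1
        have := Real.pi_pos.ne'
        field_simp
    _ = _ := by
        rw [h3, Real.sqrt_eq_rpow, Real.sqrt_eq_rpow, ← Real.rpow_mul (by positivity),
          ← Real.rpow_neg (by positivity)]
        norm_num

theorem gaussianReal_le_smul_volume (m : ℝ) {v : ℝ≥0} (hv : v ≠ 0) :
    gaussianReal m v ≤ ENNReal.ofReal ((√(2 * Real.pi * v))⁻¹) • (volume : Measure ℝ) := by
  rw [gaussianReal_of_var_ne_zero m hv, ← withDensity_const]
  exact withDensity_mono (.of_forall fun x ↦ ENNReal.ofReal_le_ofReal (gaussianPDFReal_le m v x))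

theorem volume_annulus_le (a b : ℝ) {s r : ℝ} (hsr : s < r) :
    volume {p : ℝ × ℝ | (p.1 - a) ^ 2 + (p.2 - b) ^ 2 ∈ Set.Ioc s r} ≤
      ENNReal.ofReal (Real.pi * (r - s)) := by
  have hmeas : MeasurableSet {p : ℝ × ℝ | (p.1 - a) ^ 2 + (p.2 - b) ^ 2 ∈ Set.Ioc s r} :=
    measurableSet_Ioc.preimage (by fun_prop)
  rw [← Complex.volume_preserving_equiv_real_prod.measure_preimage hmeas.nullMeasurableSet]
  set c : ℂ := ⟨a, b⟩ with hc
  have hset : (Complex.measurableEquivRealProd ⁻¹'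
      {p : ℝ × ℝ | (p.1 - a) ^ 2 + (p.2 - b) ^ 2 ∈ Set.Ioc s r})
      = {z : ℂ | dist z c ^ 2 ∈ Set.Ioc s r} := by
    ext z
    have : dist z c ^ 2 = (z.re - a) ^ 2 + (z.im - b) ^ 2 := by
      rw [dist_eq_norm, Complex.sq_norm, Complex.normSq_apply]
      simp [hc]
      ring
    simp [this]
  rw [hset]
  have hball : ∀ r : ℝ, 0 ≤ r →
      volume (Metric.closedBall c (√r)) = ENNReal.ofReal (Real.pi * r) := by
    intro r hr
    rw [Complex.volume_closedBall, ← ENNReal.ofReal_pow (Real.sqrt_nonneg r), Real.sq_sqrt hr,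
      mul_comm, ENNReal.ofReal_mul Real.pi_pos.le]
    congr 1
    exact (ENNReal.ofReal_coe_nnreal (p := NNReal.pi)).symm
  rcases lt_or_ge r 0 with hr | hr
  · have : {z : ℂ | dist z c ^ 2 ∈ Set.Ioc s r} = ∅ := by
      ext z
      simp only [Set.mem_ofPred_eq, Set.mem_Ioc, Set.mem_empty_iff_false, iff_false, not_and, not_le]
      intro _
      exact hr.trans_le (sq_nonneg _)
    rw [this, measure_empty]
    exact zero_le
  have hsub : {z : ℂ | dist z c ^ 2 ∈ Set.Ioc s r} ⊆ Metric.closedBall c (√r) := fun z hz ↦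
    Metric.mem_closedBall.2 (Real.le_sqrt_of_sq_le hz.2)
  rcases lt_or_ge s 0 with hs | hs
  · refine (measure_mono hsub).trans ?_
    rw [hball r hr]
    exact ENNReal.ofReal_le_ofReal (mul_le_mul_of_nonneg_left (by linarith) Real.pi_pos.le)
  · have hsub2 : {z : ℂ | dist z c ^ 2 ∈ Set.Ioc s r} ⊆
        Metric.closedBall c (√r) \ Metric.closedBall c (√s) := fun z hz ↦ by
      refine ⟨hsub hz, fun hz2 ↦ ?_⟩
      have := hz.1
      rw [← Real.sqrt_lt_sqrt_iff hs, Real.sqrt_sq dist_nonneg] at this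
      exact absurd (Metric.mem_closedBall.1 hz2) (not_le.2 this)
    refine (measure_mono hsub2).trans ?_
    rw [measure_sdiff (Metric.closedBall_subset_closedBall (Real.sqrt_le_sqrt hsr.le))
      Metric.isClosed_closedBall.measurableSet.nullMeasurableSet (by rw [hball s hs]; simp),
      hball r hr, hball s hs, ← ENNReal.ofReal_sub _ (by positivity), mul_sub]

theorem gaussianReal_prod_annulus_le {v w : ℝ≥0} (hv : v ≠ 0) (hw : w ≠ 0) (a b : ℝ) {s r : ℝ}
    (hsr : s < r) : ((gaussianReal 0 v).prod (gaussianReal 0 w))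
        {p : ℝ × ℝ | (p.1 - a) ^ 2 + (p.2 - b) ^ 2 ∈ Set.Ioc s r} ≤
      ((v * w) ^ (-(1 / 2) : ℝ) : ℝ≥0) * ENNReal.ofReal (r - s) := by
  have hv0 : (0 : ℝ) < v := NNReal.coe_pos.2 (pos_iff_ne_zero.2 hv)
  have hw0 : (0 : ℝ) < w := NNReal.coe_pos.2 (pos_iff_ne_zero.2 hw)
  have hle := Measure.prod_mono (gaussianReal_le_smul_volume 0 hv)
    (gaussianReal_le_smul_volume 0 hw)
  refine (hle _).trans ?_
  rw [Measure.prod_smul_left, Measure.prod_smul_right, Measure.smul_apply, Measure.smul_apply,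
    smul_eq_mul, smul_eq_mul]
  have hvol := volume_annulus_le a b hsr
  rw [Measure.volume_eq_prod] at hvol
  refine (mul_le_mul_right (mul_le_mul_right hvol _) _).trans ?_
  rw [← ENNReal.ofReal_coe_nnreal, ← ENNReal.ofReal_mul (by positivity),
    ← ENNReal.ofReal_mul (by positivity), ← ENNReal.ofReal_mul (by positivity)]
  refine ENNReal.ofReal_le_ofReal ?_
  have h0 : 0 < r - s := sub_pos.2 hsr
  have h1 : (√(2 * Real.pi * v))⁻¹ * (√(2 * Real.pi * w))⁻¹
      = (2 * Real.pi)⁻¹ * (v * w : ℝ) ^ (-(1 / 2) : ℝ) := by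
    rw [← mul_inv, ← Real.sqrt_mul (by positivity),
      show 2 * Real.pi * (v : ℝ) * (2 * Real.pi * w) = (2 * Real.pi) ^ 2 * (v * w) by ring,
      Real.sqrt_mul (by positivity), Real.sqrt_sq (by positivity), mul_inv,
      Real.rpow_neg (by positivity), Real.sqrt_eq_rpow]
  push_cast
  rw [← mul_assoc, h1]
  have hR : 0 ≤ (v * w : ℝ) ^ (-(1 / 2) : ℝ) := by positivity
  calc (2 * Real.pi)⁻¹ * (v * w : ℝ) ^ (-(1 / 2) : ℝ) * (Real.pi * (r - s))
      = (1 / 2) * ((v * w : ℝ) ^ (-(1 / 2) : ℝ) * (r - s)) := by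
        have := Real.pi_pos.ne'
        field_simp
    _ ≤ 1 * ((v * w : ℝ) ^ (-(1 / 2) : ℝ) * (r - s)) := by
        gcongr
        norm_num
    _ = _ := one_mul _

/-- After completing the square, the preimage is covered by the vertex and the images of `N` under
the two inverse branches. These are differentiable above the minimum `κ`, hence preserve null sets.
-/
theorem volume_preimage_quadratic_eq_zero {α : ℝ} (hα : 0 < α) (β δ : ℝ) {N : Set ℝ}
    (hN : volume N = 0) : volume {x : ℝ | α * x ^ 2 + β * x + δ ∈ N} = 0 := by
  set m := -(β / (2 * α)) with hm
  set κ := δ - β ^ 2 / (4 * α) with hκ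
  have hq : ∀ x, α * x ^ 2 + β * x + δ = α * (x - m) ^ 2 + κ := fun x ↦ by
    rw [hm, hκ]; field_simp; ring
  set N' := N ∩ Set.Ioi κ with hN'
  have hN0 : volume N' = 0 := measure_mono_null Set.inter_subset_left hN
  have hd : DifferentiableOn ℝ (fun y ↦ √((y - κ) / α)) N' := by
    intro y hy
    refine DifferentiableAt.differentiableWithinAt (DifferentiableAt.sqrt (by fun_prop) ?_)
    exact (div_pos (sub_pos.2 hy.2) hα).ne'
  have h1 := addHaar_image_eq_zero_of_differentiableOn_of_addHaar_eq_zero volume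
    (hd.const_add m) hN0
  have h2 := addHaar_image_eq_zero_of_differentiableOn_of_addHaar_eq_zero volume
    (hd.const_sub m) hN0
  refine measure_mono_null (t := ({m} ∪ (fun y ↦ m + √((y - κ) / α)) '' N') ∪
    (fun y ↦ m - √((y - κ) / α)) '' N') ?_
    (measure_union_null (measure_union_null (measure_singleton _) h1) h2)
  intro x hx
  rw [Set.mem_ofPred_eq, hq] at hx
  have hsq : ∀ x, (α * (x - m) ^ 2 + κ - κ) / α = (x - m) ^ 2 := fun x ↦ by field_simp; ring
  have hmem : x ≠ m → α * (x - m) ^ 2 + κ ∈ N' := fun hne ↦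
    ⟨hx, by
      have : 0 < (x - m) ^ 2 := by have := sub_ne_zero.2 hne; positivity
      exact lt_add_of_pos_left κ (mul_pos hα this)⟩
  rcases lt_trichotomy x m with h | h | h
  · refine Or.inr ⟨_, hmem h.ne, ?_⟩
    simp only [hsq, Real.sqrt_sq_eq_abs, abs_of_neg (sub_neg.2 h)]
    ring
  · exact Or.inl (Or.inl h)
  · refine Or.inl (Or.inr ⟨_, hmem h.ne', ?_⟩)
    simp only [hsq, Real.sqrt_sq_eq_abs, abs_of_pos (sub_pos.2 h)]
    ring

/-- Fubini: a bound that is uniform over the frozen values of `Y` survives averaging over `Y`. -/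
theorem map_apply_le_of_indepFun {Ω E F G : Type*} [MeasurableSpace Ω] [MeasurableSpace E]
    [MeasurableSpace F] [MeasurableSpace G] {P : Measure Ω} [IsProbabilityMeasure P]
    {X : Ω → E} {Y : Ω → F}
    (hX : AEMeasurable X P) (hY : AEMeasurable Y P) (hXY : IndepFun X Y P) {f : E × F → G}
    (hf : Measurable f) {B : Set G} (hB : MeasurableSet B) {c : ℝ≥0∞}
    (h : ∀ y, P.map X {x | f (x, y) ∈ B} ≤ c) : P.map (fun ω ↦ f (X ω, Y ω)) B ≤ c := by
  have := Measure.isProbabilityMeasure_map hY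
  have hmap : P.map (fun ω ↦ f (X ω, Y ω)) = ((P.map X).prod (P.map Y)).map f := by
    rw [← (indepFun_iff_map_prod_eq_prod_map_map hX hY).1 hXY,
      AEMeasurable.map_map_of_aemeasurable hf.aemeasurable (hX.prodMk hY)]
    rfl
  rw [hmap, Measure.map_apply hf hB, Measure.prod_apply_symm (hf hB)]
  calc _ ≤ ∫⁻ _, c ∂(P.map Y) := lintegral_mono h
    _ = c := by simp

/-! ### Centred Gaussian elements of a Hilbert space -/

section Hilbert

open scoped InnerProductSpace

variable {H : Type*} [NormedAddCommGroup H] [InnerProductSpace ℝ H]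

/-- The component of a vector orthogonal to a finite family. -/
def residual {ι : Type*} [Fintype ι] (e : ι → H) : H →L[ℝ] H :=
  ContinuousLinearMap.id ℝ H - ∑ i, (innerSL ℝ (e i)).smulRight (e i)

theorem residual_apply {ι : Type*} [Fintype ι] (e : ι → H) (z : H) :
    residual e z = z - ∑ i, ⟪e i, z⟫_ℝ • e i := by
  simp [residual]

theorem norm_sq_eq_sum_add_residual {ι : Type*} [Fintype ι] {e : ι → H} (he : Orthonormal ℝ e)
    (z : H) : ‖z‖ ^ 2 = ∑ i, ⟪e i, z⟫_ℝ ^ 2 + ‖residual e z‖ ^ 2 := by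
  have h1 : ⟪z, ∑ i, ⟪e i, z⟫_ℝ • e i⟫_ℝ = ∑ i, ⟪e i, z⟫_ℝ ^ 2 := by
    rw [inner_sum]
    refine Finset.sum_congr rfl fun i _ ↦ ?_
    rw [real_inner_smul_right, real_inner_comm, sq]
  have h2 : ‖∑ i, ⟪e i, z⟫_ℝ • e i‖ ^ 2 = ∑ i, ⟪e i, z⟫_ℝ ^ 2 := by
    rw [← real_inner_self_eq_norm_sq, he.inner_sum]
    simp [sq]
  rw [residual_apply, norm_sub_sq_real, h1, h2]
  ring

theorem residual_eq_zero {ι : Type*} [Fintype ι] {e : ι → H} (he : Orthonormal ℝ e) (i : ι) :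
    residual e (e i) = 0 := by
  classical
  rw [residual_apply, sub_eq_zero]
  simp [orthonormal_iff_ite.1 he]

variable [MeasurableSpace H] [BorelSpace H] {Ω : Type*} [MeasurableSpace Ω] {P : Measure Ω}
  {ξ : Ω → H}

theorem hasGaussianLaw_inner (hξ : HasGaussianLaw ξ P) (x : H) :
    HasGaussianLaw (fun ω ↦ ⟪x, ξ ω⟫_ℝ) P :=
  hξ.map_fun (innerSL ℝ x)

variable [CompleteSpace H]

theorem isSymmetric_covarianceOperator (ξ : Ω → H) :
    (covarianceOperator (P.map ξ) : H →ₗ[ℝ] H).IsSymmetric :=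
  isPositive_covarianceOperator.isSymmetric

variable [SecondCountableTopology H]

theorem inner_covarianceOperator_map (hξ : HasGaussianLaw ξ P) (x y : H) :
    ⟪covarianceOperator (P.map ξ) x, y⟫_ℝ = ∫ ω, ⟪x, ξ ω⟫_ℝ * ⟪y, ξ ω⟫_ℝ ∂P := by
  have := hξ.isGaussian_map
  rw [covarianceOperator_inner IsGaussian.memLp_two_id,
    integral_map hξ.aemeasurable (by fun_prop)]

theorem integral_inner_eq_zero (hξ : HasGaussianLaw ξ P) (h0 : ∫ ω, ξ ω ∂P = 0) (x : H) :
    ∫ ω, ⟪x, ξ ω⟫_ℝ ∂P = 0 := by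
  rw [integral_inner hξ.integrable, h0, inner_zero_right]

theorem covariance_inner [IsProbabilityMeasure P] (hξ : HasGaussianLaw ξ P) (h0 : ∫ ω, ξ ω ∂P = 0) (x y : H) :
    cov[fun ω ↦ ⟪x, ξ ω⟫_ℝ, fun ω ↦ ⟪y, ξ ω⟫_ℝ; P] = ⟪covarianceOperator (P.map ξ) x, y⟫_ℝ := by
  rw [covariance_eq_sub (hasGaussianLaw_inner hξ x).memLp_two (hasGaussianLaw_inner hξ y).memLp_two,
    integral_inner_eq_zero hξ h0, zero_mul, sub_zero, inner_covarianceOperator_map hξ]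
  rfl

theorem map_inner_eq_gaussianReal [IsProbabilityMeasure P] (hξ : HasGaussianLaw ξ P) (h0 : ∫ ω, ξ ω ∂P = 0) (x : H) :
    P.map (fun ω ↦ ⟪x, ξ ω⟫_ℝ) =
      gaussianReal 0 (⟪covarianceOperator (P.map ξ) x, x⟫_ℝ).toNNReal := by
  rw [(hasGaussianLaw_inner hξ x).map_eq_gaussianReal, integral_inner_eq_zero hξ h0,
    ← covariance_self (hasGaussianLaw_inner hξ x).aemeasurable, covariance_inner hξ h0]

theorem traceLE_covarianceOperator [IsProbabilityMeasure P] (hξ : HasGaussianLaw ξ P) :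
    TraceLE (covarianceOperator (P.map ξ)) (∫ ω, ‖ξ ω‖ ^ 2 ∂P) := by
  intro n e he
  have hi : ∀ i, Integrable (fun ω ↦ ⟪e i, ξ ω⟫_ℝ * ⟪e i, ξ ω⟫_ℝ) P := fun i ↦
    (hasGaussianLaw_inner hξ (e i)).memLp_two.integrable_mul
      (hasGaussianLaw_inner hξ (e i)).memLp_two
  simp_rw [inner_covarianceOperator_map hξ]
  rw [← integral_finsetSum _ fun i _ ↦ hi i]
  refine integral_mono (integrable_finsetSum _ fun i _ ↦ hi i) ?_ fun ω ↦ ?_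
  · exact hξ.memLp_two.integrable_norm_pow (by norm_num)
  · have := he.sum_inner_products_le (ξ ω) (s := Finset.univ)
    simpa [sq] using this

/-- The two maps are jointly Gaussian, and the covariance of ⟪e i, ξ⟫ with ⟪y, B ξ⟫ is ⟪B S (e i),
y⟫ = 0, where S is the covariance operator. -/
theorem indepFun_inner_of_apply_eq_zero {F : Type*} [NormedAddCommGroup F] [InnerProductSpace ℝ F]
    [CompleteSpace F] [SecondCountableTopology F] [MeasurableSpace F] [BorelSpace F]
    {ι : Type*} [Fintype ι] [IsProbabilityMeasure P] (hξ : HasGaussianLaw ξ P) (h0 : ∫ ω, ξ ω ∂P = 0)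
    (e : ι → H) (B : H →L[ℝ] F) (hB : ∀ i, B (covarianceOperator (P.map ξ) (e i)) = 0) :
    IndepFun (fun ω i ↦ ⟪e i, ξ ω⟫_ℝ) (fun ω ↦ B (ξ ω)) P := by
  let A : H →L[ℝ] EuclideanSpace ℝ ι :=
    (PiLp.continuousLinearEquiv 2 ℝ (fun _ : ι ↦ ℝ)).symm.toContinuousLinearMap ∘L
      ContinuousLinearMap.pi fun i ↦ innerSL ℝ (e i)
  have hind : IndepFun (fun ω ↦ A (ξ ω)) (fun ω ↦ B (ξ ω)) P := by
    refine HasGaussianLaw.indepFun_of_covariance_inner (hξ.map_fun (A.prod B)) fun x y ↦ ?_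
    have h1 : ∀ z, ⟪x, A z⟫_ℝ = ⟪∑ i, x i • e i, z⟫_ℝ := fun z ↦ by
      rw [sum_inner, PiLp.inner_apply]
      refine Finset.sum_congr rfl fun i _ ↦ ?_
      rw [real_inner_smul_left]
      simp [A, mul_comm]
    have h2 : ∀ z, ⟪y, B z⟫_ℝ = ⟪B.adjoint y, z⟫_ℝ := fun z ↦
      (ContinuousLinearMap.adjoint_inner_left B z y).symm
    simp_rw [h1, h2]
    rw [covariance_inner hξ h0, ContinuousLinearMap.adjoint_inner_right, map_sum, map_sum,
      sum_inner]
    refine Finset.sum_eq_zero fun i _ ↦ ?_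
    rw [map_smul, map_smul, hB, smul_zero, inner_zero_left]
  exact hind.comp (φ := fun x : EuclideanSpace ℝ ι ↦ (fun i ↦ x i)) (ψ := id)
    (by fun_prop) measurable_id

theorem iIndepFun_inner_of_eigenvectors {ι : Type*} [Fintype ι] [IsProbabilityMeasure P]
    (hξ : HasGaussianLaw ξ P)
    (h0 : ∫ ω, ξ ω ∂P = 0) {e : ι → H} {γ : ι → ℝ} (he : Orthonormal ℝ e)
    (hγ : ∀ i, covarianceOperator (P.map ξ) (e i) = γ i • e i) :
    iIndepFun (fun i ω ↦ ⟪e i, ξ ω⟫_ℝ) P := by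
  refine HasGaussianLaw.iIndepFun_of_covariance_eq_zero
    (hξ.map_fun (ContinuousLinearMap.pi fun i ↦ innerSL ℝ (e i))) fun i j hij ↦ ?_
  rw [covariance_inner hξ h0, hγ, real_inner_smul_left, he.2 hij, mul_zero]

end Hilbert

/-! ### The squared distance of a Gaussian element to a point -/

section SquaredNorm

open scoped InnerProductSpace

variable {H : Type*} [NormedAddCommGroup H] [InnerProductSpace ℝ H] [CompleteSpace H]
  [SecondCountableTopology H] [MeasurableSpace H] [BorelSpace H]
  {Ω : Type*} [MeasurableSpace Ω] {P : Measure Ω} [IsProbabilityMeasure P] {ξ : Ω → H}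

/-- By Pythagoras the exponential splits into independent factors; the one carried by the residual
has modulus 1 and is discarded. -/
theorem norm_charFun_le_prod_of_eigenvectors {ι : Type*} [Fintype ι] (hξ : HasGaussianLaw ξ P)
    (h0 : ∫ ω, ξ ω ∂P = 0) {e : ι → H} {γ : ι → ℝ} (he : Orthonormal ℝ e)
    (hγ : ∀ i, covarianceOperator (P.map ξ) (e i) = γ i • e i) (hpos : ∀ i, 0 < γ i)
    (a : H) (t : ℝ) :
    ‖charFun (P.map fun ω ↦ ‖ξ ω - a‖ ^ 2) t‖ ≤
      ∏ i, (1 + 4 * γ i ^ 2 * t ^ 2) ^ (-(1 / 4) : ℝ) := by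
  have hξm := hξ.aemeasurable
  set F : (ι → ℝ) → ℂ := fun x ↦
    ∏ i, Complex.exp (t * ((x i - ⟪e i, a⟫_ℝ) ^ 2 : ℝ) * Complex.I) with hF
  set G : H → ℂ := fun y ↦ Complex.exp (t * (‖y - residual e a‖ ^ 2 : ℝ) * Complex.I) with hG
  have hFm : Measurable F := by fun_prop
  have hGm : Measurable G := by fun_prop
  have hdec : ∀ ω, Complex.exp (t * (‖ξ ω - a‖ ^ 2 : ℝ) * Complex.I)
      = F (fun i ↦ ⟪e i, ξ ω⟫_ℝ) * G (residual e (ξ ω)) := by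
    intro ω
    rw [hF, hG]
    simp only
    rw [← Complex.exp_sum, ← Complex.exp_add, norm_sq_eq_sum_add_residual he, map_sub]
    congr 1
    rw [← Finset.sum_mul, ← Finset.mul_sum, ← add_mul, ← mul_add]
    congr 2
    push_cast
    congr 1
    refine Finset.sum_congr rfl fun i _ ↦ ?_
    rw [inner_sub_right]
    push_cast
    rfl
  have hind := indepFun_inner_of_apply_eq_zero hξ h0 e (residual e) fun i ↦ by
    rw [hγ, map_smul, residual_eq_zero he, smul_zero]
  have hXm : ∀ i, AEMeasurable (fun ω ↦ ⟪e i, ξ ω⟫_ℝ) P := fun i ↦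
    (hasGaussianLaw_inner hξ (e i)).aemeasurable
  rw [charFun_apply_real, integral_map (by fun_prop) (by fun_prop)]
  simp_rw [hdec]
  rw [hind.integral_fun_comp_mul_comp (aemeasurable_pi_lambda _ hXm) (by fun_prop)
    hFm.aestronglyMeasurable hGm.aestronglyMeasurable, norm_mul]
  have hG1 : ‖∫ ω, G (residual e (ξ ω)) ∂P‖ ≤ 1 := by
    refine (norm_integral_le_of_norm_le_const (C := 1) (.of_forall fun ω ↦ ?_)).trans (by simp)
    rw [hG]
    simp only
    rw [← Complex.ofReal_mul, Complex.norm_exp_ofReal_mul_I]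
  refine (mul_le_of_le_one_right (norm_nonneg _) hG1).trans ?_
  rw [hF, (iIndepFun_inner_of_eigenvectors hξ h0 he hγ).integral_fun_prod_comp
    (f := fun i x ↦ Complex.exp (t * ((x - ⟪e i, a⟫_ℝ) ^ 2 : ℝ) * Complex.I)) hXm
    (fun i ↦ by fun_prop), norm_prod]
  refine Finset.prod_le_prod (fun i _ ↦ norm_nonneg _) fun i _ ↦ ?_
  have hvar : (⟪covarianceOperator (P.map ξ) (e i), e i⟫_ℝ).toNNReal = (γ i).toNNReal := by
    rw [hγ, real_inner_smul_left, real_inner_self_eq_norm_sq, he.norm_eq_one, one_pow, mul_one]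
  have h1 := norm_integral_cexp_sq_gaussianReal_le (v := (γ i).toNNReal)
    (Real.toNNReal_pos.2 (hpos i)).ne' ⟪e i, a⟫_ℝ t
  rwa [← hvar, ← map_inner_eq_gaussianReal hξ h0, integral_map (hXm i) (by fun_prop), hvar,
    Real.coe_toNNReal _ (hpos i).le] at h1

theorem norm_charFun_le_prod_ell (hξ : HasGaussianLaw ξ P) (h0 : ∫ ω, ξ ω ∂P = 0) (a : H) (t : ℝ)
    (n : ℕ) : ‖charFun (P.map fun ω ↦ ‖ξ ω - a‖ ^ 2) t‖ ≤
      ∏ j ∈ Finset.range n,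
        (1 + 4 * (ell (covarianceOperator (P.map ξ)) j : ℝ) ^ 2 * t ^ 2) ^ (-(1 / 4) : ℝ) := by
  have hξm := hξ.aemeasurable
  have : IsProbabilityMeasure (P.map fun ω ↦ ‖ξ ω - a‖ ^ 2) :=
    Measure.isProbabilityMeasure_map (by fun_prop)
  induction n with
  | zero => simpa using norm_charFun_le_one t
  | succ n ih =>
    rcases le_or_gt (eigenvalueSeq (covarianceOperator (P.map ξ)) n) 0 with hn | hn
    · rw [Finset.prod_range_succ]
      have : ell (covarianceOperator (P.map ξ)) n = 0 := Real.toNNReal_of_nonpos hn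
      simpa [this] using ih
    · obtain ⟨e, γ, he, hγ⟩ := exists_orthonormal_eigenvectors
        (isSymmetric_covarianceOperator ξ) (traceLE_covarianceOperator hξ) hn
      refine (norm_charFun_le_prod_of_eigenvectors hξ h0 he (fun i ↦ (hγ i).1)
        (fun i ↦ (hγ i).2.1) a t).trans ?_
      rw [Finset.prod_range]
      refine Finset.prod_le_prod (fun i _ ↦ Real.rpow_nonneg (by positivity) _) fun i _ ↦ ?_
      refine Real.rpow_le_rpow_of_nonpos (by positivity) ?_ (by norm_num)
      have : (ell (covarianceOperator (P.map ξ)) i : ℝ) ≤ γ i := by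
        rw [ell, Real.coe_toNNReal']
        exact max_le (hγ i).2.2 (hγ i).2.1.le
      gcongr

/-- By Bernoulli with exponent p = 3ℓ_j²/B² ≤ 1, (1 + B²t²)^p ≤ 1 + 3ℓ_j²t². The exponents of the
resulting powers add up to -3/4 in the limit. -/
theorem le_of_forall_le_mul_prod {ℓ : ℕ → ℝ≥0} {B : ℝ≥0} (hB : B ≠ 0)
    (hℓ : ∀ j, 3 * ℓ j ^ 2 ≤ B ^ 2) (hsum : HasSum (fun j ↦ ℓ j ^ 2) (B ^ 2)) {c D t : ℝ}
    (hD : 0 ≤ D) (h : ∀ n, c ≤ D * ∏ j ∈ Finset.range n,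
      (1 + 4 * (ℓ j : ℝ) ^ 2 * t ^ 2) ^ (-(1 / 4) : ℝ)) :
    c ≤ D * (1 + (B : ℝ) ^ 2 * t ^ 2) ^ (-(3 / 4) : ℝ) := by
  have hB0 : (0 : ℝ) < B := NNReal.coe_pos.2 (pos_iff_ne_zero.2 hB)
  have hbase : (0 : ℝ) < 1 + (B : ℝ) ^ 2 * t ^ 2 := by positivity
  have hfac : ∀ j, (1 + 4 * (ℓ j : ℝ) ^ 2 * t ^ 2) ^ (-(1 / 4) : ℝ) ≤
      (1 + (B : ℝ) ^ 2 * t ^ 2) ^ (-(3 / 4) * ((ℓ j : ℝ) ^ 2 / (B : ℝ) ^ 2)) := by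
    intro j
    have hj : 3 * (ℓ j : ℝ) ^ 2 ≤ (B : ℝ) ^ 2 := by exact_mod_cast hℓ j
    have hb := rpow_one_add_le_one_add_mul_self (s := (B : ℝ) ^ 2 * t ^ 2)
      (by linarith [show 0 ≤ (B : ℝ) ^ 2 * t ^ 2 by positivity])
      (p := 3 * (ℓ j : ℝ) ^ 2 / (B : ℝ) ^ 2) (by positivity)
      ((div_le_one (by positivity)).2 hj)
    have hb2 : (1 + (B : ℝ) ^ 2 * t ^ 2) ^ (3 * (ℓ j : ℝ) ^ 2 / (B : ℝ) ^ 2) ≤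
        1 + 4 * (ℓ j : ℝ) ^ 2 * t ^ 2 := by
      refine hb.trans ?_
      have : 3 * (ℓ j : ℝ) ^ 2 / (B : ℝ) ^ 2 * ((B : ℝ) ^ 2 * t ^ 2) = 3 * (ℓ j : ℝ) ^ 2 * t ^ 2 := by
        field_simp
      rw [this]
      nlinarith [show 0 ≤ (ℓ j : ℝ) ^ 2 * t ^ 2 by positivity]
    refine (Real.rpow_le_rpow_of_nonpos (by positivity) hb2 (by norm_num)).trans_eq ?_
    rw [← Real.rpow_mul hbase.le]
    congr 1
    ring
  have hlim : Filter.Tendsto (fun n ↦ D * (1 + (B : ℝ) ^ 2 * t ^ 2) ^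
      (-(3 / 4) * ((∑ j ∈ Finset.range n, (ℓ j : ℝ) ^ 2) / (B : ℝ) ^ 2))) Filter.atTop
      (nhds (D * (1 + (B : ℝ) ^ 2 * t ^ 2) ^ (-(3 / 4) * ((B : ℝ) ^ 2 / (B : ℝ) ^ 2)))) := by
    have hs : Filter.Tendsto (fun n ↦ ∑ j ∈ Finset.range n, (ℓ j : ℝ) ^ 2) Filter.atTop
        (nhds ((B : ℝ) ^ 2)) := by
      have := (NNReal.hasSum_coe.2 hsum).tendsto_sum_nat
      simpa using this
    refine Filter.Tendsto.const_mul D ?_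
    exact ((Real.continuous_const_rpow hbase.ne').tendsto _).comp
      ((hs.div_const _).const_mul _)
  rw [div_self (by positivity), mul_one] at hlim
  refine ge_of_tendsto' hlim fun n ↦ (h n).trans ?_
  refine mul_le_mul_of_nonneg_left ?_ hD
  refine (Finset.prod_le_prod (fun j _ ↦ Real.rpow_nonneg (by positivity) _)
    fun j _ ↦ hfac j).trans_eq ?_
  rw [← Real.rpow_sum_of_pos hbase, ← Finset.mul_sum, Finset.sum_div]

theorem map_norm_sq_le_of_le {B : ℝ≥0} (hξ : HasGaussianLaw ξ P) (h0 : ∫ ω, ξ ω ∂P = 0)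
    (hB : B ≠ 0) (hℓ : 3 * ell (covarianceOperator (P.map ξ)) 0 ^ 2 ≤ B ^ 2)
    (hsum : HasSum (fun j ↦ ell (covarianceOperator (P.map ξ)) j ^ 2) (B ^ 2)) (a : H) :
    P.map (fun ω ↦ ‖ξ ω - a‖ ^ 2) ≤ ((charFunConst + 1) * (B * B) ^ (-(1 / 2) : ℝ)) • volume := by
  have hξm := hξ.aemeasurable
  have : IsProbabilityMeasure (P.map fun ω ↦ ‖ξ ω - a‖ ^ 2) :=
    Measure.isProbabilityMeasure_map (by fun_prop)
  have hB0 : (0 : ℝ) < B := NNReal.coe_pos.2 (pos_iff_ne_zero.2 hB)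
  refine le_smul_volume_of_charFun_le (pos_iff_ne_zero.2 hB) (pos_iff_ne_zero.2 hB) fun t ht ↦ ?_
  have h1 := le_of_forall_le_mul_prod hB (fun j ↦ le_trans (by
    gcongr
    exact ell_antitone _ (Nat.zero_le j)) hℓ) hsum zero_le_one (t := t)
    fun n ↦ (norm_charFun_le_prod_ell hξ h0 a t n).trans_eq (one_mul _).symm
  rw [one_mul] at h1
  refine h1.trans ?_
  have hbase : (0 : ℝ) < 1 + (B : ℝ) ^ 2 * t ^ 2 := by positivity
  have hBt : 0 < B * |t| := mul_pos hB0 (abs_pos.2 ht)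
  -- The exponent 3/4 is split as 1/4 + 1/2 to fit the two-parameter bound with A = B.
  calc (1 + (B : ℝ) ^ 2 * t ^ 2) ^ (-(3 / 4) : ℝ)
      = (1 + (B : ℝ) ^ 2 * t ^ 2) ^ (-(1 / 4) : ℝ) *
        (1 + (B : ℝ) ^ 2 * t ^ 2) ^ (-(1 / 2) : ℝ) := by
        rw [← Real.rpow_add hbase]; norm_num
    _ ≤ ((B * |t|) ^ 2) ^ (-(1 / 4) : ℝ) * (1 + (B : ℝ) ^ 2 * t ^ 2) ^ (-(1 / 2) : ℝ) := by
        refine mul_le_mul_of_nonneg_right ?_ (by positivity)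
        refine Real.rpow_le_rpow_of_nonpos (by positivity) ?_ (by norm_num)
        rw [mul_pow, sq_abs]
        linarith
    _ = _ := by
        rw [← Real.rpow_natCast, ← Real.rpow_mul hBt.le]; norm_num

theorem map_norm_sq_le_of_tail_le {B : ℝ≥0} (hξ : HasGaussianLaw ξ P) (h0 : ∫ ω, ξ ω ∂P = 0)
    (hB : B ≠ 0) (h1 : ell (covarianceOperator (P.map ξ)) 0 ≠ 0)
    (hℓ : 3 * ell (covarianceOperator (P.map ξ)) 1 ^ 2 ≤ B ^ 2)
    (hsum : HasSum (fun j ↦ ell (covarianceOperator (P.map ξ)) (j + 1) ^ 2) (B ^ 2)) (a : H) :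
    P.map (fun ω ↦ ‖ξ ω - a‖ ^ 2) ≤ ((charFunConst + 1) *
      (ell (covarianceOperator (P.map ξ)) 0 * B) ^ (-(1 / 2) : ℝ)) • volume := by
  have hξm := hξ.aemeasurable
  have : IsProbabilityMeasure (P.map fun ω ↦ ‖ξ ω - a‖ ^ 2) :=
    Measure.isProbabilityMeasure_map (by fun_prop)
  refine le_smul_volume_of_charFun_le (pos_iff_ne_zero.2 h1) (pos_iff_ne_zero.2 hB) fun t ht ↦ ?_
  set A := ell (covarianceOperator (P.map ξ)) 0 with hA
  have hA0 : (0 : ℝ) < A := NNReal.coe_pos.2 (pos_iff_ne_zero.2 h1)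
  have h2 := le_of_forall_le_mul_prod hB (fun j ↦ le_trans (by
    gcongr
    exact ell_antitone _ (Nat.le_add_left 1 j)) hℓ) hsum (t := t)
    (D := (1 + 4 * (A : ℝ) ^ 2 * t ^ 2) ^ (-(1 / 4) : ℝ)) (Real.rpow_nonneg (by positivity) _)
    -- The factor of the largest eigenvalue is split off as `D`, so that Bernoulli is applied to the
    -- tail only.
    fun n ↦ (norm_charFun_le_prod_ell hξ h0 a t (n + 1)).trans_eq
      ((Finset.prod_range_succ' _ n).trans (mul_comm _ _))
  refine h2.trans ?_
  have hAt : 0 < A * |t| := mul_pos hA0 (abs_pos.2 ht)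
  refine mul_le_mul ?_ ?_ (by positivity) (by positivity)
  · calc (1 + 4 * (A : ℝ) ^ 2 * t ^ 2) ^ (-(1 / 4) : ℝ)
        ≤ ((A * |t|) ^ 2) ^ (-(1 / 4) : ℝ) := by
          refine Real.rpow_le_rpow_of_nonpos (by positivity) ?_ (by norm_num)
          rw [mul_pow, sq_abs]
          nlinarith [show 0 ≤ (A : ℝ) ^ 2 * t ^ 2 by positivity]
      _ = _ := by
          rw [← Real.rpow_natCast, ← Real.rpow_mul hAt.le]; norm_num
  · refine Real.rpow_le_rpow_of_exponent_le ?_ (by norm_num)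
    linarith [show 0 ≤ (B : ℝ) ^ 2 * t ^ 2 by positivity]

theorem map_norm_sq_le_of_two_eigenvectors (hξ : HasGaussianLaw ξ P) (h0 : ∫ ω, ξ ω ∂P = 0)
    {e : Fin 2 → H} {γ : Fin 2 → ℝ≥0} (he : Orthonormal ℝ e)
    (hγ : ∀ i, covarianceOperator (P.map ξ) (e i) = (γ i : ℝ) • e i) (hpos : ∀ i, γ i ≠ 0)
    (a : H) : P.map (fun ω ↦ ‖ξ ω - a‖ ^ 2) ≤ ((γ 0 * γ 1) ^ (-(1 / 2) : ℝ) : ℝ≥0) • volume := by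
  have hξm := hξ.aemeasurable
  have hXm : ∀ i, AEMeasurable (fun ω ↦ ⟪e i, ξ ω⟫_ℝ) P := fun i ↦
    (hasGaussianLaw_inner hξ (e i)).aemeasurable
  have hlaw : ∀ i, P.map (fun ω ↦ ⟪e i, ξ ω⟫_ℝ) = gaussianReal 0 (γ i) := fun i ↦ by
    rw [map_inner_eq_gaussianReal hξ h0, hγ, real_inner_smul_left, real_inner_self_eq_norm_sq,
      he.norm_eq_one, one_pow, mul_one, Real.toNNReal_coe]
  have hpair : P.map (fun ω ↦ (⟪e 0, ξ ω⟫_ℝ, ⟪e 1, ξ ω⟫_ℝ)) =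
      (gaussianReal 0 (γ 0)).prod (gaussianReal 0 (γ 1)) := by
    rw [(indepFun_iff_map_prod_eq_prod_map_map (hXm 0) (hXm 1)).1
      ((iIndepFun_inner_of_eigenvectors hξ h0 he hγ).indepFun zero_ne_one), hlaw, hlaw]
  have hind : IndepFun (fun ω ↦ (⟪e 0, ξ ω⟫_ℝ, ⟪e 1, ξ ω⟫_ℝ)) (fun ω ↦ residual e (ξ ω)) P :=
    (indepFun_inner_of_apply_eq_zero hξ h0 e (residual e) fun i ↦ by
      rw [hγ, map_smul, residual_eq_zero he, smul_zero]).comp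
      (φ := fun x ↦ (x 0, x 1)) (ψ := id) (by fun_prop) measurable_id
  refine le_smul_volume_of_Ioc
    (NNReal.rpow_pos (pos_iff_ne_zero.2 (mul_ne_zero (hpos 0) (hpos 1)))).ne' fun s r hsr ↦ ?_
  set f : (ℝ × ℝ) × H → ℝ := fun p ↦ (p.1.1 - ⟪e 0, a⟫_ℝ) ^ 2 + (p.1.2 - ⟪e 1, a⟫_ℝ) ^ 2 +
    ‖p.2 - residual e a‖ ^ 2 with hf
  have hdec : (fun ω ↦ ‖ξ ω - a‖ ^ 2) =
      fun ω ↦ f ((⟪e 0, ξ ω⟫_ℝ, ⟪e 1, ξ ω⟫_ℝ), residual e (ξ ω)) := by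
    ext ω
    rw [norm_sq_eq_sum_add_residual he, Fin.sum_univ_two, inner_sub_right, inner_sub_right, map_sub]
  rw [hdec]
  refine map_apply_le_of_indepFun ((hXm 0).prodMk (hXm 1)) (by fun_prop) hind (by fun_prop)
    measurableSet_Ioc fun y ↦ ?_
  rw [hpair]
  set q := ‖y - residual e a‖ ^ 2 with hq
  have hset : {x : ℝ × ℝ | f (x, y) ∈ Set.Ioc s r} =
      {p : ℝ × ℝ | (p.1 - ⟪e 0, a⟫_ℝ) ^ 2 + (p.2 - ⟪e 1, a⟫_ℝ) ^ 2 ∈ Set.Ioc (s - q) (r - q)} := by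
    ext p
    simp only [hf, Set.mem_ofPred_eq, Set.mem_Ioc, sub_lt_iff_lt_add, le_sub_iff_add_le, hq]
  rw [hset]
  refine (gaussianReal_prod_annulus_le (hpos 0) (hpos 1) _ _ (sub_lt_sub_right hsr q)).trans_eq ?_
  rw [sub_sub_sub_cancel_right]

theorem map_norm_sq_le_of_ell_ne_zero (hξ : HasGaussianLaw ξ P) (h0 : ∫ ω, ξ ω ∂P = 0)
    (h1 : ell (covarianceOperator (P.map ξ)) 1 ≠ 0) (a : H) :
    P.map (fun ω ↦ ‖ξ ω - a‖ ^ 2) ≤ ((ell (covarianceOperator (P.map ξ)) 0 *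
      ell (covarianceOperator (P.map ξ)) 1) ^ (-(1 / 2) : ℝ) : ℝ≥0) • volume := by
  have hn : 0 < eigenvalueSeq (covarianceOperator (P.map ξ)) 1 :=
    Real.toNNReal_pos.1 (pos_iff_ne_zero.2 h1)
  obtain ⟨e, γ, he, hγ⟩ := exists_orthonormal_eigenvectors
    (isSymmetric_covarianceOperator ξ) (traceLE_covarianceOperator hξ) hn
  have hle := map_norm_sq_le_of_two_eigenvectors hξ h0 (γ := fun i ↦ (γ i).toNNReal) he
    (fun i ↦ by rw [Real.coe_toNNReal _ (hγ i).2.1.le]; exact (hγ i).1)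
    (fun i ↦ (Real.toNNReal_pos.2 (hγ i).2.1).ne') a
  refine hle.trans ?_
  have hell : ∀ i : Fin 2, ell (covarianceOperator (P.map ξ)) i ≤ (γ i).toNNReal := fun i ↦
    Real.toNNReal_le_toNNReal (hγ i).2.2
  have h0' : 0 < ell (covarianceOperator (P.map ξ)) 0 :=
    (pos_iff_ne_zero.2 h1).trans_le (ell_antitone _ zero_le_one)
  have hc : ((γ 0).toNNReal * (γ 1).toNNReal) ^ (-(1 / 2) : ℝ) ≤
      (ell (covarianceOperator (P.map ξ)) 0 * ell (covarianceOperator (P.map ξ)) 1)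
        ^ (-(1 / 2) : ℝ) := by
    rw [NNReal.rpow_neg, NNReal.rpow_neg]
    refine inv_anti₀ (NNReal.rpow_pos (mul_pos h0' (pos_iff_ne_zero.2 h1))) ?_
    exact NNReal.rpow_le_rpow (mul_le_mul' (hell 0) (hell 1)) (by norm_num)
  refine Measure.le_iff'.2 fun s ↦ ?_
  simp only [Measure.smul_apply, ENNReal.smul_def, smul_eq_mul]
  gcongr

/-- Rank one is allowed, so a single direction must do: ξ = ⟪e, ξ⟫u + Bξ with independent summands.
Given Bξ, the squared norm is a nondegenerate quadratic polynomial in a nondegenerate Gaussian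
variable. -/
theorem hasPDF_norm_sq (hξ : HasGaussianLaw ξ P) (h0 : ∫ ω, ξ ω ∂P = 0)
    (hS : covarianceOperator (P.map ξ) ≠ 0) (a : H) :
    HasPDF (fun ω ↦ ‖ξ ω - a‖ ^ 2) P volume := by
  have hξm := hξ.aemeasurable
  set S := covarianceOperator (P.map ξ) with hSdef
  have hpos : S.toLinearMap.IsPositive := isPositive_covarianceOperator
  obtain ⟨e, he⟩ : ∃ e, ⟪S e, e⟫_ℝ ≠ 0 := by
    by_contra! h
    refine hS (ContinuousLinearMap.coe_injective ?_)
    exact hpos.isSymmetric.inner_map_self_eq_zero.1 h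
  set v := ⟪S e, e⟫_ℝ with hv
  have hv0 : 0 < v := lt_of_le_of_ne (hpos.inner_nonneg_left e) he.symm
  -- The scaling gives ⟪e, u⟫ = 1, so that `B` kills `S e`; this yields the independence.
  set u := v⁻¹ • S e with hu
  have hu0 : u ≠ 0 := smul_ne_zero (inv_ne_zero he) fun h ↦ he (by rw [hv, h, inner_zero_left])
  set B : H →L[ℝ] H := ContinuousLinearMap.id ℝ H - (innerSL ℝ e).smulRight u with hB
  have hBapp : ∀ z, B z = z - ⟪e, z⟫_ℝ • u := fun z ↦ by simp [hB]
  have hBS : B (S e) = 0 := by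
    rw [hBapp, real_inner_comm, ← hv, hu, smul_smul, mul_inv_cancel₀ he, one_smul, sub_self]
  have hind : IndepFun (fun ω ↦ ⟪e, ξ ω⟫_ℝ) (fun ω ↦ B (ξ ω)) P :=
    (indepFun_inner_of_apply_eq_zero hξ h0 (fun _ : Unit ↦ e) B fun _ ↦ hBS).comp
      (φ := fun x : Unit → ℝ ↦ x ()) (ψ := id) (by fun_prop) measurable_id
  set f : ℝ × H → ℝ := fun p ↦ ‖p.1 • u + p.2 - a‖ ^ 2 with hf
  have hdec : (fun ω ↦ ‖ξ ω - a‖ ^ 2) = fun ω ↦ f (⟪e, ξ ω⟫_ℝ, B (ξ ω)) := by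
    ext ω
    simp only [hf, hBapp, add_sub_cancel]
  have hac : P.map (fun ω ↦ ‖ξ ω - a‖ ^ 2) ≪ volume := by
    refine Measure.AbsolutelyContinuous.mk fun N hN hN0 ↦ ?_
    rw [hdec]
    refine le_antisymm (map_apply_le_of_indepFun (hasGaussianLaw_inner hξ e).aemeasurable
      (by fun_prop) hind (by fun_prop) hN fun y ↦ ?_) zero_le
    rw [map_inner_eq_gaussianReal hξ h0]
    refine (gaussianReal_absolutelyContinuous 0 (Real.toNNReal_pos.2 hv0).ne' ?_).le
    have hset : {x : ℝ | f (x, y) ∈ N} =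
        {x : ℝ | ‖u‖ ^ 2 * x ^ 2 + 2 * ⟪u, y - a⟫_ℝ * x + ‖y - a‖ ^ 2 ∈ N} := by
      ext x
      have : f (x, y) = ‖u‖ ^ 2 * x ^ 2 + 2 * ⟪u, y - a⟫_ℝ * x + ‖y - a‖ ^ 2 := by
        rw [hf]
        simp only
        rw [add_sub_assoc, norm_add_sq_real, norm_smul, real_inner_smul_left, mul_pow,
          Real.norm_eq_abs, sq_abs]
        ring
      simp only [Set.mem_ofPred_eq, this]
    rw [hset]
    exact volume_preimage_quadratic_eq_zero (by have := norm_pos_iff.2 hu0; positivity) _ _ hN0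
  have : IsProbabilityMeasure (P.map fun ω ↦ ‖ξ ω - a‖ ^ 2) :=
    Measure.isProbabilityMeasure_map (by fun_prop)
  exact ⟨by fun_prop, inferInstance, hac⟩

end SquaredNorm

/-! ### The quantity `kap` -/

theorem rpow_neg_half_le {X Y : ℝ≥0∞} (h : Y ≤ 4 * X) :
    X ^ (-(1 / 2) : ℝ) ≤ 2 * Y ^ (-(1 / 2) : ℝ) := by
  have h4 : (4 : ℝ≥0∞) ^ (1 / 2 : ℝ) = 2 := by
    rw [show (4 : ℝ≥0∞) = 2 ^ (2 : ℝ) by norm_num, ← ENNReal.rpow_mul]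
    norm_num
  have h1 : Y ^ (1 / 2 : ℝ) ≤ 2 * X ^ (1 / 2 : ℝ) := by
    refine (ENNReal.rpow_le_rpow h (by norm_num)).trans_eq ?_
    rw [ENNReal.mul_rpow_of_nonneg _ _ (by norm_num), h4]
  rw [ENNReal.rpow_neg, ENNReal.rpow_neg]
  calc (X ^ (1 / 2 : ℝ))⁻¹ = 2 * (2 * X ^ (1 / 2 : ℝ))⁻¹ := by
        rw [ENNReal.mul_inv (by simp) (by simp), ← mul_assoc,
          ENNReal.mul_inv_cancel (by simp) (by simp), one_mul]
    _ ≤ _ := by gcongr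

section Kap

variable {H : Type*} [NormedAddCommGroup H] [InnerProductSpace ℝ H]

theorem LamSq_two_le_LamSq_one (T : H →L[ℝ] H) : LamSq T 2 ≤ LamSq T 1 := by
  refine le_trans (le_of_eq (tsum_congr fun j ↦ ?_)) (ENNReal.tsum_comp_le_tsum_of_injective
    Nat.succ_injective fun j ↦ lam T (1 + j) ^ 2)
  rw [show 2 + j = 1 + j.succ by omega]

theorem Lam_le_two_mul {T : H →L[ℝ] H} {k : ℕ} (h : ¬ 3 * lam T k ^ 2 ≤ LamSq T k) :
    Lam T k ≤ 2 * lam T k := by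
  have h1 : LamSq T k ≤ (2 * lam T k) ^ (2 : ℝ) := by
    refine (not_le.1 h).le.trans ?_
    rw [ENNReal.rpow_ofNat, mul_pow]
    gcongr
    norm_num
  refine (ENNReal.rpow_le_rpow h1 (by norm_num : (0 : ℝ) ≤ 1 / 2)).trans_eq ?_
  rw [← ENNReal.rpow_mul]
  norm_num

theorem rpow_mul_self_neg_half (X : ℝ≥0∞) : (X * X) ^ (-(1 / 2) : ℝ) = X⁻¹ := by
  rw [← sq, ← ENNReal.rpow_natCast, ← ENNReal.rpow_mul, ← ENNReal.rpow_neg_one]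
  norm_num

theorem kap_le (T : H →L[ℝ] H) : kap T ≤ 2 * (Lam T 1 * Lam T 2) ^ (-(1 / 2) : ℝ) := by
  unfold kap
  split_ifs with h1 h2
  · rw [← rpow_mul_self_neg_half]
    refine rpow_neg_half_le ?_
    calc Lam T 1 * Lam T 2 ≤ Lam T 1 * Lam T 1 := by
          gcongr
          exact ENNReal.rpow_le_rpow (LamSq_two_le_LamSq_one T) (by norm_num)
      _ ≤ 4 * (Lam T 1 * Lam T 1) := le_mul_of_one_le_left zero_le (by norm_num)
  · refine rpow_neg_half_le ?_
    calc Lam T 1 * Lam T 2 ≤ 2 * lam T 1 * Lam T 2 := by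
          gcongr
          exact Lam_le_two_mul h1
      _ ≤ 4 * (lam T 1 * Lam T 2) := by
          rw [mul_assoc]
          gcongr
          norm_num
  · refine rpow_neg_half_le ?_
    calc Lam T 1 * Lam T 2 ≤ 2 * lam T 1 * (2 * lam T 2) :=
          mul_le_mul' (Lam_le_two_mul h1) (Lam_le_two_mul h2)
      _ = 4 * (lam T 1 * lam T 2) := by ring

theorem LamSq_succ_eq_coe {T : H →L[ℝ] H} (hs : Summable fun j ↦ ell T j ^ 2) (k : ℕ) :
    LamSq T (k + 1) = ((∑' j, ell T (j + k) ^ 2 : ℝ≥0) : ℝ≥0∞) := by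
  rw [ENNReal.coe_tsum (NNReal.summable_nat_add _ hs k), LamSq]
  refine tsum_congr fun j ↦ ?_
  rw [show k + 1 + j = j + k + 1 by ring, lam_succ, ENNReal.coe_pow]

theorem exists_Lam_succ_eq_coe {T : H →L[ℝ] H} (hs : Summable fun j ↦ ell T j ^ 2) (k : ℕ) :
    ∃ B : ℝ≥0, HasSum (fun j ↦ ell T (j + k) ^ 2) (B ^ 2) ∧ LamSq T (k + 1) = (B : ℝ≥0∞) ^ 2 ∧
      Lam T (k + 1) = B := by
  refine ⟨NNReal.sqrt (∑' j, ell T (j + k) ^ 2), ?_, ?_, ?_⟩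
  · rw [NNReal.sq_sqrt]
    exact (NNReal.summable_nat_add _ hs k).hasSum
  · rw [LamSq_succ_eq_coe hs, ← ENNReal.coe_pow, NNReal.sq_sqrt]
  · rw [Lam, LamSq_succ_eq_coe hs, NNReal.sqrt_eq_rpow, ENNReal.coe_rpow_of_nonneg _ (by norm_num)]

end Kap

/-! ### The density bounds -/

theorem ae_pdf_norm_sq_le_kap {H : Type*} [NormedAddCommGroup H] [InnerProductSpace ℝ H]
    [CompleteSpace H] [SecondCountableTopology H] [MeasurableSpace H] [BorelSpace H]
    {Ω : Type*} [MeasurableSpace Ω] {P : Measure Ω} [IsProbabilityMeasure P] {ξ : Ω → H}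
    (hξ : HasGaussianLaw ξ P) (h0 : ∫ ω, ξ ω ∂P = 0) (a : H) :
    ∀ᵐ x : ℝ, pdf (fun ω ↦ ‖ξ ω - a‖ ^ 2) P volume x ≤
      (charFunConst + 1 : ℝ≥0) * kap (covarianceOperator (P.map ξ)) := by
  have hs : Summable fun j ↦ ell (covarianceOperator (P.map ξ)) j ^ 2 :=
    summable_ell_sq (isSymmetric_covarianceOperator ξ) (traceLE_covarianceOperator hξ)
  set S := covarianceOperator (P.map ξ) with hS
  have hC : ((charFunConst + 1 : ℝ≥0) : ℝ≥0∞) ≠ 0 := by simp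
  have hmain : ∀ K : ℝ≥0, P.map (fun ω ↦ ‖ξ ω - a‖ ^ 2) ≤ K • volume →
      ∀ c : ℝ≥0∞, K ≤ c → ∀ᵐ x : ℝ, pdf (fun ω ↦ ‖ξ ω - a‖ ^ 2) P volume x ≤ c := by
    intro K hK c hc
    filter_upwards [rnDeriv_le_of_le_smul hK] with x hx using hx.trans hc
  -- If Λ_1 = 0 or Λ_2 = 0 makes `kap` infinite, the bound is vacuous.
  have htop : ∀ c : ℝ≥0∞, c = ∞ →
      ∀ᵐ x : ℝ, pdf (fun ω ↦ ‖ξ ω - a‖ ^ 2) P volume x ≤ (charFunConst + 1 : ℝ≥0) * c := by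
    rintro c rfl
    rw [ENNReal.mul_top hC]
    simp
  obtain ⟨B₁, hB₁s, hB₁sq, hB₁⟩ := exists_Lam_succ_eq_coe hs 0
  obtain ⟨B₂, hB₂s, hB₂sq, hB₂⟩ := exists_Lam_succ_eq_coe hs 1
  have hl1 : lam S 1 = ell S 0 := lam_succ S 0
  have hl2 : lam S 2 = ell S 1 := lam_succ S 1
  unfold kap
  rw [hl1, hl2, hB₁sq, hB₂sq, hB₁, hB₂]
  split_ifs with h1 h2
  · rcases eq_or_ne B₁ 0 with hz | hz
    · exact htop _ (by simp [hz])
    · refine hmain _ (map_norm_sq_le_of_le hξ h0 hz (by exact_mod_cast h1) (by simpa using hB₁s) a)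
        _ (le_of_eq ?_)
      rw [ENNReal.coe_mul, ENNReal.coe_rpow_of_ne_zero (mul_ne_zero hz hz), ENNReal.coe_mul,
        rpow_mul_self_neg_half]
  · have hl0 : ell S 0 ≠ 0 := by
      intro h
      simp [h] at h1
    rcases eq_or_ne B₂ 0 with hz | hz
    · exact htop _ (by simp [hz])
    · refine hmain _ (map_norm_sq_le_of_tail_le hξ h0 hz hl0 (by exact_mod_cast h2) hB₂s a)
        _ (le_of_eq ?_)
      rw [ENNReal.coe_mul, ENNReal.coe_rpow_of_ne_zero (mul_ne_zero hl0 hz), ENNReal.coe_mul]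
  · have hl0 : ell S 0 ≠ 0 := by
      intro h
      simp [h] at h1
    have hl1 : ell S 1 ≠ 0 := by
      intro h
      simp [h] at h2
    refine hmain _ (map_norm_sq_le_of_ell_ne_zero hξ h0 hl1 a) _ ?_
    rw [ENNReal.coe_rpow_of_ne_zero (mul_ne_zero hl0 hl1), ENNReal.coe_mul]
    refine le_mul_of_one_le_left zero_le ?_
    rw [ENNReal.coe_add, ENNReal.coe_one]
    exact le_add_self

end GaussianNorm

end

theorem mainTheorem2 :
    ∃ C : ℝ≥0, ∀ (H : Type*) [NormedAddCommGroup H] [InnerProductSpace ℝ H] [CompleteSpace H]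
      [TopologicalSpace.SeparableSpace H] [MeasurableSpace H] [BorelSpace H]
      (Ω : Type*) [MeasurableSpace Ω] (P : Measure Ω) [IsProbabilityMeasure P]
      (ξ : Ω → H) (S : H →L[ℝ] H),
      HasGaussianLaw ξ P → ∫ ω, ξ ω ∂P = 0 → S = covarianceOperator (P.map ξ) →
      -- `ϰ(S) ≤ C (Λ₁ Λ₂)^{-1/2}`
      GaussianNorm.kap S ≤
          C * (GaussianNorm.Lam S 1 * GaussianNorm.Lam S 2) ^ (-(1 / 2) : ℝ) ∧
      -- for `S ≠ 0`, `‖ξ - a‖²` has a density, bounded by `C ϰ(S)` and by `C (Λ₁ Λ₂)^{-1/2}`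
      (S ≠ 0 → ∀ a : H,
        HasPDF (fun ω ↦ ‖ξ ω - a‖ ^ 2) P volume ∧
        (∀ᵐ x : ℝ, pdf (fun ω ↦ ‖ξ ω - a‖ ^ 2) P volume x ≤ C * GaussianNorm.kap S) ∧
        (∀ᵐ x : ℝ, pdf (fun ω ↦ ‖ξ ω - a‖ ^ 2) P volume x ≤
          C * (GaussianNorm.Lam S 1 * GaussianNorm.Lam S 2) ^ (-(1 / 2) : ℝ))) := by
  -- The factor 2 is the one in `kap_le`.
  refine ⟨(GaussianNorm.charFunConst + 1) * 2, ?_⟩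
  intro H _ _ _ _ _ _ Ω _ P _ ξ S hξ h0 hS
  have : SecondCountableTopology H := UniformSpace.secondCountable_of_separable H
  have hle2 : (2 : ℝ≥0∞) ≤ ((GaussianNorm.charFunConst + 1) * 2 : ℝ≥0) := by
    push_cast
    exact le_mul_of_one_le_left zero_le le_add_self
  refine ⟨(GaussianNorm.kap_le S).trans (by gcongr), fun hS0 a ↦ ?_⟩
  subst hS
  have hpdf := GaussianNorm.ae_pdf_norm_sq_le_kap hξ h0 a
  refine ⟨GaussianNorm.hasPDF_norm_sq hξ h0 hS0 a, ?_, ?_⟩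
  · filter_upwards [hpdf] with x hx
    refine hx.trans ?_
    gcongr
    exact le_mul_of_one_le_right zero_le one_le_two
  · filter_upwards [hpdf] with x hx
    refine hx.trans ?_
    rw [ENNReal.coe_mul, mul_assoc]
    gcongr
    exact GaussianNorm.kap_le _
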